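/- Work over $\mathbb{C}$. Let $\mathfrak q\subseteq\mathfrak{gl}_N(\mathbb C)$ be the Lie algebra of a connected linear algebraic group $Q\subseteq GL_N(\mathbb C)$ with centre $Z$. For $\gamma\in\mathfrak q^*$ let $Q_\gamma$ be the stabiliser of $\gamma$ under the coadjoint action and $\mathfrak q_\gamma=\{x\in\mathfrak q\mid \gamma([x,\mathfrak q])=0\}$ its Lie algebra. The form $\gamma$ is of *reductive type* if $Q_\gamma/Z$ is a reductive subgroup of $GL(\mathfrak q)$; $\mathfrak q$ is *strongly quasi-reductive* if it has a linear form of reductive type and its centre consists of semisimple elements. In that case let $M_*(\mathfrak q)$ be the set of all subalgebras $\mathfrak q_\gamma$, where $\gamma$ is of reductive type and $\gamma(\mathfrak q_\gamma)=0$ (these are the Lie algebras of the maximal reductive stabilisers of $\mathfrak q$); otherwise put $M_*(\mathfrak q)=\varnothing$. **Theorem.** Let $n=2\ell$, let $1\le r\le\ell$, and let $\bar a=(a_1,\dots,a_t)$ be a composition of $r$ (so all $a_i\ge 1$). Let $\mathbb C^n$ carry the standard symplectic form with standard symplectic basis $e_1,\dots,e_\ell,f_1,\dots,f_\ell$, let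 $V_j$ be the span of $e_1,\dots,e_{a_1+\dots+a_j}$ for $0\le j\le t$, and let $\mathfrak p=\mathfrak p_n^{-1}(\bar a)$ be the stabiliser in $\mathfrak{sp}_n$ of the isotropic flag $V_0\subset V_1\subset\dots\subset V_t$; let $P\subseteq Sp_n$ be the connected subgroup with Lie algebra $\mathfrak p$. Embed $\mathfrak{gl}_{a_1}\oplus\dots\oplus\mathfrak{gl}_{a_t}\oplus\mathfrak{sp}_{n-2r}$ into $\mathfrak p$ as the standard Levi factor: $x_i\in\mathfrak{gl}_{a_i}$ acts by $x_i$ on the span of the $e_k$ with $a_1+\dots+a_{i-1}<k\le a_1+\dots+a_i$ and by $-x_i^{T}$ on the span of the corresponding $f_k$, and $\mathfrak{sp}_{n-2r}$ acts on the span of the $e_k,f_k$ with $k>r$. Then $\mathfrak p$ is strongly quasi-reductive, and $M_*(\mathfrak p)$ is exactly one $P$-conjugacy class of subalgebras of $\mathfrak p$, namely the class of $$\mathfrak{so}_{a_1}\oplus\dots\oplus\mathfrak{so}_{a_t}\oplus\mathfrak{sp}_{n-2r},$$ embedded (injectively) through this Levi factor, where $\mathfrak{so}_{a_i}\subseteq\mathfrak{gl}_{a_i}$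 is the algebra of skew-symmetric matrices. -/

import Mathlib

open Matrix
open scoped DirectSum

attribute [local instance 100] LieRing.ofAssociativeRing

noncomputable section

namespace MaxRed

/-! ### Connected matrix groups and their (co)adjoint representation -/

section General

variable {N : Type*} [Fintype N] [DecidableEq N]

/-- The connected Lie subgroup `Q` of `GL_N(ℂ)` with Lie algebra `q`:
the subgroup generated by the exponentials of the elements of `q`. -/
def connectedGroup (q : LieSubalgebra ℂ (Matrix N N ℂ)) : Subgroup (GL N ℂ) :=
  Subgroup.closure {g | ∃ x ∈ q, (g : Matrix N N ℂ) = NormedSpace.exp x}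

/-- If `q` is a Lie subalgebra of a finite-dimensional normed algebra and `x, y ∈ q`, then
`exp(x) y exp(-x) ∈ q`. -/
theorem exp_conj_mem_of_normed {A : Type*} [NormedRing A] [NormedAlgebra ℂ A] [CompleteSpace A]
    [FiniteDimensional ℂ A] (q : LieSubalgebra ℂ A) {x y : A} (hx : x ∈ q) (hy : y ∈ q) :
    NormedSpace.exp x * y * NormedSpace.exp (-x) ∈ q := by
  let _ : NormedAlgebra ℚ A := NormedAlgebra.restrictScalars ℚ ℂ A
  let _ : NormedAlgebra ℚ (A →L[ℂ] A) := NormedAlgebra.restrictScalars ℚ ℂ (A →L[ℂ] A)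
  let L : A →L[ℂ] (A →L[ℂ] A) := ContinuousLinearMap.mul ℂ A
  let R : A →L[ℂ] (A →L[ℂ] A) := (ContinuousLinearMap.mul ℂ A).flip
  have hLpow : ∀ (z : A) (n : ℕ), (L z) ^ n = L (z ^ n) := by
    intro z n
    induction n with
    | zero => ext1 w; simp [L]
    | succ n ih => rw [pow_succ, ih]; ext1 w; simp [L, pow_succ, mul_assoc]
  have hRpow : ∀ (z : A) (n : ℕ), (R z) ^ n = R (z ^ n) := by
    intro z n
    induction n with
    | zero => ext1 w; simp [R]
    | succ n ih => rw [pow_succ, ih]; ext1 w; simp [R, pow_succ', mul_assoc]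
  have hexp : ∀ (F : A →L[ℂ] (A →L[ℂ] A)), (∀ (z : A) (n : ℕ), (F z) ^ n = F (z ^ n)) →
      ∀ z : A, NormedSpace.exp (F z) = F (NormedSpace.exp z) := by
    intro F hF z
    have h1 := (NormedSpace.exp_series_hasSum_exp' (𝕂 := ℂ) z).mapL F
    have h2 := NormedSpace.exp_series_hasSum_exp' (𝕂 := ℂ) (F z)
    refine h2.unique ?_
    simpa only [map_smul, hF] using h1
  have hcomm : Commute (L x) (R (-x)) := by
    ext1 w; simp [L, R, mul_assoc]
  have key : NormedSpace.exp (L x + R (-x)) y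
      = NormedSpace.exp x * y * NormedSpace.exp (-x) := by
    rw [NormedSpace.exp_add_of_commute hcomm, hexp L hLpow, hexp R hRpow]
    simp [L, R, mul_assoc]
  rw [← key]
  have hstep : ∀ n : ℕ, ((L x + R (-x)) ^ n) y ∈ q := by
    intro n
    induction n with
    | zero => simpa using hy
    | succ n ih =>
      have h := q.lie_mem hx ih
      rw [pow_succ']
      have e : ((L x + R (-x)) * (L x + R (-x)) ^ n) y = ⁅x, ((L x + R (-x)) ^ n) y⁆ := by
        simp [L, R, LieRing.of_associative_ring_bracket, sub_eq_add_neg]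
      rw [e]; exact h
  have hs := (NormedSpace.exp_series_hasSum_exp' (𝕂 := ℂ) (L x + R (-x))).mapL
    (ContinuousLinearMap.apply ℂ A y)
  have hclosed : IsClosed (q.toSubmodule : Set A) :=
    Submodule.closed_of_finiteDimensional q.toSubmodule
  refine hclosed.mem_of_tendsto hs (Filter.Eventually.of_forall fun s => ?_)
  refine Submodule.sum_mem _ fun n _ => ?_
  simpa using q.toSubmodule.smul_mem _ (hstep n)

theorem exp_conj_mem (q : LieSubalgebra ℂ (Matrix N N ℂ)) {x y : Matrix N N ℂ}
    (hx : x ∈ q) (hy : y ∈ q) :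
    NormedSpace.exp x * y * NormedSpace.exp (-x) ∈ q := by
  let _ : NormedRing (Matrix N N ℂ) := Matrix.linftyOpNormedRing
  let _ : NormedAlgebra ℂ (Matrix N N ℂ) := Matrix.linftyOpNormedAlgebra
  have _ : CompleteSpace (Matrix N N ℂ) := FiniteDimensional.complete ℂ _
  exact exp_conj_mem_of_normed q hx hy

theorem conj_mem (q : LieSubalgebra ℂ (Matrix N N ℂ)) (g : connectedGroup q)
    {y : Matrix N N ℂ} (hy : y ∈ q) :
    (g.1 : Matrix N N ℂ) * y * (g.1⁻¹ : GL N ℂ) ∈ q := by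
  obtain ⟨g, hg⟩ := g
  have hval : ∀ {g : GL N ℂ} {x : Matrix N N ℂ}, (g : Matrix N N ℂ) = NormedSpace.exp x →
      ((g⁻¹ : GL N ℂ) : Matrix N N ℂ) = NormedSpace.exp (-x) := by
    intro g x h
    rw [Matrix.exp_neg, ← h, Matrix.coe_units_inv]
  induction hg using Subgroup.closure_induction'' generalizing y with
  | mem g hg =>
    obtain ⟨x, hx, h⟩ := hg
    simp only
    rw [hval h, h]
    exact exp_conj_mem q hx hy
  | inv_mem g hg =>
    obtain ⟨x, hx, h⟩ := hg
    simp only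
    rw [inv_inv, hval h, h]
    simpa using exp_conj_mem q (q.neg_mem hx) hy
  | one => simpa using hy
  | mul g h _ _ ihg ihh =>
    have := ihg (ihh hy)
    simpa [mul_assoc] using this

/-- The adjoint representation of `Q` on its Lie algebra `q`: `g` acts by `x ↦ g x g⁻¹`. -/
def Ad (q : LieSubalgebra ℂ (Matrix N N ℂ)) : Representation ℂ (connectedGroup q) q where
  toFun g :=
    { toFun := fun x => ⟨(g.1 : Matrix N N ℂ) * x.1 * (g.1⁻¹ : GL N ℂ), conj_mem q g x.2⟩
      map_add' := fun x y => by ext1; simp [mul_add, add_mul]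
      map_smul' := fun c x => by ext1; simp }
  map_one' := by ext x : 2; simp
  map_mul' g h := by ext x : 2; simp [mul_assoc]

/-- The stabiliser `Q_γ` of a linear form `γ` for the coadjoint action of `Q`. -/
def groupStabiliser (q : LieSubalgebra ℂ (Matrix N N ℂ)) (γ : Module.Dual ℂ q) :
    Subgroup (connectedGroup q) where
  carrier := {g | (Ad q).dual g γ = γ}
  one_mem' := by
    change (Ad q).dual 1 γ = γ
    rw [map_one, Module.End.one_apply]
  mul_mem' := by
    intro g h hg hh
    simp only [Set.mem_ofPred_eq, map_mul, Module.End.mul_apply] at *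
    rw [hh, hg]
  inv_mem' := by
    intro g hg
    simp only [Set.mem_ofPred_eq] at *
    conv_lhs => rw [← hg]
    rw [← Module.End.mul_apply, ← map_mul, inv_mul_cancel, map_one, Module.End.one_apply]

/-- The stabiliser `q_γ = {x ∈ q | γ([x, q]) = 0}`, which is the Lie algebra of `Q_γ`. -/
def lieStabiliser (q : LieSubalgebra ℂ (Matrix N N ℂ)) (γ : Module.Dual ℂ q) :
    LieSubalgebra ℂ q where
  carrier := {x | ∀ y : q, γ ⁅x, y⁆ = 0}
  zero_mem' := by intro y; simp
  add_mem' := by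
    intro a b ha hb y
    rw [add_lie, map_add, ha, hb, add_zero]
  smul_mem' := by
    intro c a ha y
    rw [smul_lie, map_smul, ha, smul_zero]
  lie_mem' := by
    intro a b ha hb y
    rw [lie_lie, map_sub, ha, hb, sub_zero]

/-- A subgroup `H` of `GL(V)` is reductive if its only normal subgroup consisting of unipotent
elements is the trivial one.

For a Zariski-closed `H` over `ℂ` this says that the unipotent radical is trivial: the Zariski
closure of a normal unipotent subgroup is again normal and unipotent, and it is connected because
the characteristic is zero. -/
def IsReductiveSubgroup {V : Type*} [AddCommGroup V] [Module ℂ V]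
    (H : Subgroup (LinearMap.GeneralLinearGroup ℂ V)) : Prop :=
  ∀ U : Subgroup (LinearMap.GeneralLinearGroup ℂ V), U ≤ H →
    (∀ h ∈ H, ∀ u ∈ U, h * u * h⁻¹ ∈ U) →
    (∀ u ∈ U, IsNilpotent ((u : Module.End ℂ V) - 1)) → U = ⊥

/-- `γ ∈ q*` is of reductive type if `Q_γ / Z` is a reductive subgroup of `GL(q)`, where `Z` is
the centre of `Q`. Since `Q` is connected, `Z` is the kernel of the adjoint representation of `Q`,
so that `Q_γ / Z ⊆ GL(q)` is the image of `Q_γ` under the adjoint representation. -/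
def IsOfReductiveType (q : LieSubalgebra ℂ (Matrix N N ℂ)) (γ : Module.Dual ℂ q) : Prop :=
  IsReductiveSubgroup ((groupStabiliser q γ).map (Ad q).toHomUnits)

/-- `γ ∈ q*` is of nilpotent type if `γ` vanishes on `q_γ`. -/
def IsOfNilpotentType (q : LieSubalgebra ℂ (Matrix N N ℂ)) (γ : Module.Dual ℂ q) : Prop :=
  ∀ x ∈ lieStabiliser q γ, γ x = 0

/-- `q` is strongly quasi-reductive if it has a linear form of reductive type and its centre
consists of semisimple matrices. -/
def IsStronglyQuasiReductive (q : LieSubalgebra ℂ (Matrix N N ℂ)) : Prop :=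
  (∃ γ : Module.Dual ℂ q, IsOfReductiveType q γ) ∧
    ∀ z ∈ LieAlgebra.center ℂ q, Module.End.IsSemisimple (Matrix.toLin' (z : Matrix N N ℂ))

/-- `M_*(q)`: the set of the Lie algebras of the maximal reductive stabilisers of `q`, that is of
all `q_γ` with `γ` of reductive type and `γ(q_γ) = 0`, if `q` is strongly quasi-reductive; and
the empty set otherwise. -/
def MStar (q : LieSubalgebra ℂ (Matrix N N ℂ)) : Set (LieSubalgebra ℂ q) :=
  {m | IsStronglyQuasiReductive q ∧
    ∃ γ : Module.Dual ℂ q, IsOfReductiveType q γ ∧ IsOfNilpotentType q γ ∧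
      m = lieStabiliser q γ}

/-- The `Q`-conjugacy class of a Lie subalgebra `m` of `q`. -/
def conjugacyClass (q : LieSubalgebra ℂ (Matrix N N ℂ)) (m : LieSubalgebra ℂ q) :
    Set (LieSubalgebra ℂ q) :=
  {m' | ∃ g : connectedGroup q, m'.toSubmodule = m.toSubmodule.map (Ad q g)}

end General

/-! ### The standard parabolic subalgebras of `sp_{2ℓ}` -/

section Symplectic

/-- Index set of cardinality `ℓ` (if `r ≤ ℓ`), cut into blocks of sizes `a_1, …, a_t, ℓ - r`. -/
abbrev Idx (ℓ : ℕ) {r : ℕ} (a : Composition r) : Type :=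
  (Σ i : Fin a.length, Fin (a.blocksFun i)) ⊕ Fin (ℓ - r)

/-- `ℂ^{2ℓ}` has the symplectic basis `e_k, f_k`, with `k` in `Idx ℓ a`, where `e_k` and `f_k` are
the unit vectors at `Sum.inl k` and `Sum.inr k`. The `j`-th member of the standard isotropic flag is
the span of the `e_k` with `k` in one of the first `j` blocks; its dimension is `a_1 + ⋯ + a_j`. -/
def flag (ℓ : ℕ) {r : ℕ} (a : Composition r) (j : Fin (a.length + 1)) :
    Submodule ℂ (Idx ℓ a ⊕ Idx ℓ a → ℂ) :=
  Submodule.span ℂ {v | ∃ (i : Fin a.length) (k : Fin (a.blocksFun i)),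
    i.val < j.val ∧ v = Pi.single (Sum.inl (Sum.inl ⟨i, k⟩)) 1}

/-- The parabolic subalgebra `p_n^{-1}(a)` of `sp_n`, `n = 2ℓ`: the stabiliser in `sp_n` of the
standard isotropic flag. -/
def parabolic (ℓ : ℕ) {r : ℕ} (a : Composition r) :
    LieSubalgebra ℂ (Matrix (Idx ℓ a ⊕ Idx ℓ a) (Idx ℓ a ⊕ Idx ℓ a) ℂ) where
  carrier := {x | x ∈ LieAlgebra.Symplectic.sp (Idx ℓ a) ℂ ∧
    ∀ j, ∀ v ∈ flag ℓ a j, x *ᵥ v ∈ flag ℓ a j}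
  zero_mem' := ⟨zero_mem _, fun j v _ => by simp⟩
  add_mem' := fun hx hy => ⟨add_mem hx.1 hy.1, fun j v hv => by
    rw [Matrix.add_mulVec]; exact add_mem (hx.2 j v hv) (hy.2 j v hv)⟩
  smul_mem' := fun c x hx => ⟨LieSubalgebra.smul_mem _ c hx.1, fun j v hv => by
    rw [Matrix.smul_mulVec]; exact Submodule.smul_mem _ c (hx.2 j v hv)⟩
  lie_mem' := fun {x y} hx hy => ⟨LieSubalgebra.lie_mem _ hx.1 hy.1, fun j v hv => by
    rw [LieRing.of_associative_ring_bracket, Matrix.sub_mulVec, ← Matrix.mulVec_mulVec,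
      ← Matrix.mulVec_mulVec]
    exact sub_mem (hx.2 j _ (hy.2 j v hv)) (hy.2 j _ (hx.2 j v hv))⟩

/-- The matrix of the element `(x_1, …, x_t, y)` of the standard Levi factor
`gl_{a_1} ⊕ ⋯ ⊕ gl_{a_t} ⊕ sp_{n-2r}`: here `x_i` acts as itself on the span of the `e_k` with `k`
in the `i`-th block and as `-x_iᵀ` on the span of the corresponding `f_k`, and `y` acts on the
span of the `e_k, f_k` with `k` in the last block. -/
def leviMatrix (ℓ : ℕ) {r : ℕ} (a : Composition r)
    (x : ∀ i : Fin a.length, Matrix (Fin (a.blocksFun i)) (Fin (a.blocksFun i)) ℂ)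
    (y : Matrix (Fin (ℓ - r) ⊕ Fin (ℓ - r)) (Fin (ℓ - r) ⊕ Fin (ℓ - r)) ℂ) :
    Matrix (Idx ℓ a ⊕ Idx ℓ a) (Idx ℓ a ⊕ Idx ℓ a) ℂ :=
  fromBlocks
    (fromBlocks (blockDiagonal' x) 0 0 y.toBlocks₁₁) (fromBlocks 0 0 0 y.toBlocks₁₂)
    (fromBlocks 0 0 0 y.toBlocks₂₁) (fromBlocks (-(blockDiagonal' x)ᵀ) 0 0 y.toBlocks₂₂)

theorem leviMatrix_lie (ℓ : ℕ) {r : ℕ} (a : Composition r)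
    (x x' : ∀ i : Fin a.length, Matrix (Fin (a.blocksFun i)) (Fin (a.blocksFun i)) ℂ)
    (y y' : Matrix (Fin (ℓ - r) ⊕ Fin (ℓ - r)) (Fin (ℓ - r) ⊕ Fin (ℓ - r)) ℂ) :
    leviMatrix ℓ a (fun i => x i * x' i - x' i * x i) (y * y' - y' * y) =
      leviMatrix ℓ a x y * leviMatrix ℓ a x' y' - leviMatrix ℓ a x' y' * leviMatrix ℓ a x y := by
  have h : blockDiagonal' (fun i => x i * x' i - x' i * x i) =
      blockDiagonal' x * blockDiagonal' x' - blockDiagonal' x' * blockDiagonal' x := by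
    rw [← blockDiagonal'_mul, ← blockDiagonal'_mul, ← blockDiagonal'_sub]; rfl
  obtain ⟨A, B, C, D, rfl⟩ : ∃ A B C D, y = fromBlocks A B C D :=
    ⟨_, _, _, _, (fromBlocks_toBlocks y).symm⟩
  obtain ⟨A', B', C', D', rfl⟩ : ∃ A B C D, y' = fromBlocks A B C D :=
    ⟨_, _, _, _, (fromBlocks_toBlocks y').symm⟩
  simp only [leviMatrix, h]
  simp only [sub_eq_add_neg, fromBlocks_neg, fromBlocks_add, fromBlocks_multiply,
    transpose_add, transpose_neg, transpose_mul, toBlocks_fromBlocks₁₁, toBlocks_fromBlocks₁₂,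
    toBlocks_fromBlocks₂₁, toBlocks_fromBlocks₂₂]
  simp [add_comm]

theorem leviMatrix_add (ℓ : ℕ) {r : ℕ} (a : Composition r)
    (x x' : ∀ i : Fin a.length, Matrix (Fin (a.blocksFun i)) (Fin (a.blocksFun i)) ℂ)
    (y y' : Matrix (Fin (ℓ - r) ⊕ Fin (ℓ - r)) (Fin (ℓ - r) ⊕ Fin (ℓ - r)) ℂ) :
    leviMatrix ℓ a (fun i => x i + x' i) (y + y') = leviMatrix ℓ a x y + leviMatrix ℓ a x' y' := by
  have h : blockDiagonal' (fun i => x i + x' i) = blockDiagonal' x + blockDiagonal' x' :=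
    blockDiagonal'_add x x'
  obtain ⟨A, B, C, D, rfl⟩ : ∃ A B C D, y = fromBlocks A B C D :=
    ⟨_, _, _, _, (fromBlocks_toBlocks y).symm⟩
  obtain ⟨A', B', C', D', rfl⟩ : ∃ A B C D, y' = fromBlocks A B C D :=
    ⟨_, _, _, _, (fromBlocks_toBlocks y').symm⟩
  simp only [leviMatrix, h, fromBlocks_add, toBlocks_fromBlocks₁₁, toBlocks_fromBlocks₁₂,
    toBlocks_fromBlocks₂₁, toBlocks_fromBlocks₂₂, add_zero, transpose_add, neg_add]

theorem leviMatrix_smul (ℓ : ℕ) {r : ℕ} (a : Composition r) (c : ℂ)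
    (x : ∀ i : Fin a.length, Matrix (Fin (a.blocksFun i)) (Fin (a.blocksFun i)) ℂ)
    (y : Matrix (Fin (ℓ - r) ⊕ Fin (ℓ - r)) (Fin (ℓ - r) ⊕ Fin (ℓ - r)) ℂ) :
    leviMatrix ℓ a (fun i => c • x i) (c • y) = c • leviMatrix ℓ a x y := by
  have h : blockDiagonal' (fun i => c • x i) = c • blockDiagonal' x :=
    blockDiagonal'_smul c x
  obtain ⟨A, B, C, D, rfl⟩ : ∃ A B C D, y = fromBlocks A B C D :=
    ⟨_, _, _, _, (fromBlocks_toBlocks y).symm⟩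
  simp only [leviMatrix, h, fromBlocks_smul, toBlocks_fromBlocks₁₁, toBlocks_fromBlocks₁₂,
    toBlocks_fromBlocks₂₁, toBlocks_fromBlocks₂₂, smul_zero, transpose_smul, smul_neg]

theorem leviMatrix_mem (ℓ : ℕ) {r : ℕ} (a : Composition r)
    (x : ∀ i : Fin a.length, Matrix (Fin (a.blocksFun i)) (Fin (a.blocksFun i)) ℂ)
    (y : Matrix (Fin (ℓ - r) ⊕ Fin (ℓ - r)) (Fin (ℓ - r) ⊕ Fin (ℓ - r)) ℂ)
    (hy : y ∈ LieAlgebra.Symplectic.sp (Fin (ℓ - r)) ℂ) :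
    leviMatrix ℓ a x y ∈ parabolic ℓ a := by
  obtain ⟨A, B, C, D, rfl⟩ : ∃ A B C D, y = fromBlocks A B C D :=
    ⟨_, _, _, _, (fromBlocks_toBlocks y).symm⟩
  refine ⟨?_, ?_⟩
  · rw [LieAlgebra.Symplectic.sp, mem_skewAdjointMatricesLieSubalgebra,
      mem_skewAdjointMatricesSubmodule] at hy ⊢
    simp only [Matrix.IsSkewAdjoint, Matrix.IsAdjointPair, Matrix.J, fromBlocks_transpose,
      fromBlocks_multiply, fromBlocks_neg] at hy ⊢
    simp only [leviMatrix, ← fromBlocks_one, fromBlocks_transpose,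
      fromBlocks_multiply, fromBlocks_neg]
    simp [fromBlocks_inj] at hy ⊢
    tauto
  · intro j v hv
    rw [flag] at hv
    induction hv using Submodule.span_induction with
    | zero => simp
    | add v w _ _ hv hw => rw [Matrix.mulVec_add]; exact add_mem hv hw
    | smul c v _ hv => rw [Matrix.mulVec_smul]; exact Submodule.smul_mem _ c hv
    | mem v hv =>
      obtain ⟨i, k, hij, rfl⟩ := hv
      have : leviMatrix ℓ a x (fromBlocks A B C D) *ᵥ Pi.single (Sum.inl (Sum.inl ⟨i, k⟩)) 1 =
          ∑ k', x i k' k • (Pi.single (Sum.inl (Sum.inl ⟨i, k'⟩)) 1 :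
            Idx ℓ a ⊕ Idx ℓ a → ℂ) := by
        rw [Matrix.mulVec_single_one]
        ext s
        rcases s with (⟨i', k'⟩ | s) | (s | s) <;>
          simp [leviMatrix, blockDiagonal'_apply, Finset.sum_apply, Pi.single_apply]
        by_cases h : i' = i
        · subst h; simp
        · simp [h]
      rw [this]
      exact Submodule.sum_mem _ fun k' _ => Submodule.smul_mem _ _
        (Submodule.subset_span ⟨i, k', hij, rfl⟩)

/-- The embedding of the standard Levi factor `gl_{a_1} ⊕ ⋯ ⊕ gl_{a_t} ⊕ sp_{n-2r}` into the
parabolic subalgebra. -/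
def leviEmbedding (ℓ : ℕ) {r : ℕ} (a : Composition r) :
    ((⨁ i : Fin a.length, Matrix (Fin (a.blocksFun i)) (Fin (a.blocksFun i)) ℂ) ×
      LieAlgebra.Symplectic.sp (Fin (ℓ - r)) ℂ) →ₗ⁅ℂ⁆ parabolic ℓ a where
  toFun z := ⟨leviMatrix ℓ a (fun i => z.1 i) z.2.1, leviMatrix_mem ℓ a _ z.2.1 z.2.2⟩
  map_add' z w := Subtype.ext (leviMatrix_add ℓ a (fun i => z.1 i) (fun i => w.1 i) z.2.1 w.2.1)
  map_smul' c z := Subtype.ext (leviMatrix_smul ℓ a c (fun i => z.1 i) z.2.1)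
  map_lie' {z w} := Subtype.ext (by
    change leviMatrix ℓ a (fun i => ⁅z.1, w.1⁆ i) (z.2.1 * w.2.1 - w.2.1 * z.2.1) = _
    simp only [DirectSum.bracket_apply]
    exact leviMatrix_lie ℓ a (fun i => z.1 i) (fun i => w.1 i) z.2.1 w.2.1)

/-- The inclusion of `so_{a_1} ⊕ ⋯ ⊕ so_{a_t} ⊕ sp_{n-2r}` into
`gl_{a_1} ⊕ ⋯ ⊕ gl_{a_t} ⊕ sp_{n-2r}`: the identity on every entry. -/
def soInclusion (ℓ : ℕ) {r : ℕ} (a : Composition r) :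
    ((⨁ i : Fin a.length, LieAlgebra.Orthogonal.so (Fin (a.blocksFun i)) ℂ) ×
      LieAlgebra.Symplectic.sp (Fin (ℓ - r)) ℂ) →ₗ⁅ℂ⁆
    ((⨁ i : Fin a.length, Matrix (Fin (a.blocksFun i)) (Fin (a.blocksFun i)) ℂ) ×
      LieAlgebra.Symplectic.sp (Fin (ℓ - r)) ℂ) where
  toFun z := (DFinsupp.mapRange (fun i (x : LieAlgebra.Orthogonal.so (Fin (a.blocksFun i)) ℂ) =>
    (x : Matrix (Fin (a.blocksFun i)) (Fin (a.blocksFun i)) ℂ)) (fun _ => rfl) z.1, z.2)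
  map_add' z w := by
    refine Prod.ext (DFinsupp.ext fun i => ?_) rfl
    simp
  map_smul' c z := by
    refine Prod.ext (DFinsupp.ext fun i => ?_) rfl
    rfl
  map_lie' {z w} := by
    refine Prod.ext (DFinsupp.ext fun i => ?_) rfl
    simp only [LieAlgebra.Prod.bracket_apply]
    erw [DirectSum.bracket_apply]
    simp

/-- The embedding of `so_{a_1} ⊕ ⋯ ⊕ so_{a_t} ⊕ sp_{n-2r}` into the parabolic subalgebra, through
its standard Levi factor. -/
def standardEmbedding (ℓ : ℕ) {r : ℕ} (a : Composition r) :
    ((⨁ i : Fin a.length, LieAlgebra.Orthogonal.so (Fin (a.blocksFun i)) ℂ) ×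
      LieAlgebra.Symplectic.sp (Fin (ℓ - r)) ℂ) →ₗ⁅ℂ⁆ parabolic ℓ a :=
  (leviEmbedding ℓ a).comp (soInclusion ℓ a)

end Symplectic

end MaxRed

end

set_option linter.unusedSectionVars false

namespace MaxRed

/-! ### Nilpotency from traces, and groups of unipotent endomorphisms -/

section Trace

variable {V : Type*} [AddCommGroup V] [Module ℂ V] [FiniteDimensional ℂ V]

/-! Give `e_k` its block number `lev k` as degree and `f_k` the degree `2t - lev k`; then `p`
consists of the block upper triangular elements of `sp`. The trace pairing represents each linear
form on `p` by a matrix `(X, Y; S, -Xᵀ)` with `Y`, `S` symmetric, and the coadjoint action becomes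
conjugation. All symmetric matrices occur in the upper right corner of `p`, so the complex symmetric
matrix `S` is determined by the form.

The base form has `X = Y = 0` and `S = π`, the projection to the levels below `t`. Its stabiliser
`m` is the required sum of orthogonal and symplectic algebras (`mem_lieStabiliser_baseForm`,
`range_standardEmbedding`), and the form vanishes on `m`. It is of reductive type because its group
stabiliser is closed under conjugate transposition (`isReductiveSubgroup_of_adjoint`,
`isOfReductiveType_baseForm`).

Conversely, let `γ` be of reductive and nilpotent type. If `S` were degenerate on the span of the
`e_k` of level at most `j`, for some `j < t`, a radical vector `v` would put the nilpotent matrix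
with corner `v vᵀ` into a `Q_γ`-stable space of commuting nilpotents in `q_γ`. Reductivity makes
such a space central (`commute_of_nilpotent`), and the centre of `p` is zero. So `S` is
nondegenerate along the flag, and a block Cholesky decomposition, realised in the group, turns `S`
into the identity on the levels below `t`. A unipotent conjugation then reduces `γ` to the base form
plus the trace form of some `η ∈ m` (`exists_levelSkew_form`).

The stabiliser of that form is the centraliser of `η` in `m` (`mem_lieStabiliser_add`). Nilpotent
type forces the traces of all even powers of `η` to vanish, so `η` is nilpotent; it is then a
nilpotent element of the centre of `q_γ`, and reductive type gives `η = 0` (`eq_zero_of_types`).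
Hence every such `γ` is conjugate to the base form. -/

theorem isNilpotent_of_trace_pow_eq_zero (f : Module.End ℂ V)
    (h : ∀ k : ℕ, 1 ≤ k → LinearMap.trace ℂ V (f ^ k) = 0) : IsNilpotent f := by
  obtain ⟨q, hq, hq'⟩ := Polynomial.exists_eq_pow_rootMultiplicity_mul_and_not_dvd f.charpoly
    f.charpoly_monic.ne_zero 0
  set m := f.charpoly.rootMultiplicity 0
  rw [map_zero, sub_zero] at hq hq'
  -- The exponent `m + 1` instead of `m` keeps the idempotent below free of a constant term even
  -- when `m = 0`, so its trace involves only positive powers of `f`. It is the projection to the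
  -- part on which `f` is invertible; trace zero kills it in characteristic zero.
  have hcop : IsCoprime (Polynomial.X ^ (m + 1)) q :=
    (((Polynomial.irreducible_X (R := ℂ)).coprime_iff_not_dvd).2 hq').pow_left
  obtain ⟨u, v, huv⟩ := hcop
  have hch : Polynomial.aeval f (Polynomial.X ^ m * q) = 0 := by
    rw [← hq]; exact f.aeval_self_charpoly
  set e := Polynomial.aeval f (u * Polynomial.X ^ (m + 1)) with he
  have hidem : IsIdempotentElem e := by
    have : e * (1 - e) = 0 := by
      have h1 : (1 : Module.End ℂ V) - e = Polynomial.aeval f (v * q) := by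
        rw [he, ← map_one (Polynomial.aeval (R := ℂ) f), ← huv, map_add]; simp
      rw [h1, he, ← map_mul]
      have : u * Polynomial.X ^ (m + 1) * (v * q) =
          (u * v * Polynomial.X) * (Polynomial.X ^ m * q) := by ring
      rw [this, map_mul, hch, mul_zero]
    rw [mul_sub, mul_one, sub_eq_zero] at this
    exact this.symm
  have htr : ∀ p : Polynomial ℂ,
      LinearMap.trace ℂ V (Polynomial.aeval f (p * Polynomial.X ^ (m + 1))) = 0 := by
    intro p
    induction p using Polynomial.induction_on' with
    | add p q hp hq => rw [add_mul, map_add, map_add, hp, hq, add_zero]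
    | monomial n c =>
      rw [← Polynomial.C_mul_X_pow_eq_monomial, mul_assoc, ← pow_add, map_mul,
        Polynomial.aeval_C, map_pow, Polynomial.aeval_X, ← Algebra.smul_def, map_smul,
        h _ (by omega), smul_zero]
  have he0 : e = 0 := LinearMap.IsIdempotentElem.eq_zero_of_trace_eq_zero hidem (htr u)
  refine ⟨m, ?_⟩
  have : f ^ m = Polynomial.aeval f (Polynomial.X ^ m : Polynomial ℂ) := by simp
  rw [this, ← mul_one (Polynomial.X ^ m), ← huv]
  have h2 : (Polynomial.X : Polynomial ℂ) ^ m * (u * Polynomial.X ^ (m + 1) + v * q) =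
      Polynomial.X ^ m * (u * Polynomial.X ^ (m + 1)) + v * (Polynomial.X ^ m * q) := by ring
  rw [h2, map_add, map_mul, ← he, he0, map_mul _ v, hch]; simp

/-- Kolchin's theorem: a monoid of unipotent endomorphisms has a nonzero fixed vector. -/
theorem exists_fixed_vector [Nontrivial V] (U : Submonoid (Module.End ℂ V))
    (hU : ∀ u ∈ U, IsNilpotent (u - 1)) : ∃ v : V, v ≠ 0 ∧ ∀ u ∈ U, u v = v := by
  -- The identity `(u-1)(w-1) = (uw-1) - (u-1) - (w-1)` makes this span closed under products. All
  -- its elements have trace zero, hence so do their powers, so all are nilpotent and Engel's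
  -- theorem applies.
  let S : Submodule ℂ (Module.End ℂ V) := Submodule.span ℂ {a | ∃ u ∈ U, a = u - 1}
  have hmul : ∀ a ∈ S, ∀ b ∈ S, a * b ∈ S := by
    intro a ha b hb
    induction ha using Submodule.span_induction with
    | zero => simp
    | add x y _ _ hx hy => rw [add_mul]; exact add_mem hx hy
    | smul c x _ hx => rw [smul_mul_assoc]; exact S.smul_mem c hx
    | mem x hx =>
      obtain ⟨u, hu, rfl⟩ := hx
      induction hb using Submodule.span_induction with
      | zero => simp
      | add x y _ _ hx hy => rw [mul_add]; exact add_mem hx hy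
      | smul c x _ hx => rw [mul_smul_comm]; exact S.smul_mem c hx
      | mem x hx =>
        obtain ⟨w, hw, rfl⟩ := hx
        have : (u - 1) * (w - 1) = (u * w - 1) - (u - 1) - (w - 1) := by noncomm_ring
        rw [this]
        exact sub_mem (sub_mem (Submodule.subset_span ⟨_, U.mul_mem hu hw, rfl⟩)
          (Submodule.subset_span ⟨_, hu, rfl⟩)) (Submodule.subset_span ⟨_, hw, rfl⟩)
  have htr : ∀ a ∈ S, LinearMap.trace ℂ V a = 0 := by
    intro a ha
    induction ha using Submodule.span_induction with
    | zero => simp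
    | add x y _ _ hx hy => rw [map_add, hx, hy, add_zero]
    | smul c x _ hx => rw [map_smul, hx, smul_zero]
    | mem x hx =>
      obtain ⟨u, hu, rfl⟩ := hx
      exact (LinearMap.isNilpotent_trace_of_isNilpotent (hU u hu)).eq_zero
  have hpow : ∀ a ∈ S, ∀ k : ℕ, a ^ (k + 1) ∈ S := by
    intro a ha k
    induction k with
    | zero => simpa using ha
    | succ k ih => rw [pow_succ]; exact hmul _ ih _ ha
  have hnil : ∀ a ∈ S, IsNilpotent a := fun a ha =>
    isNilpotent_of_trace_pow_eq_zero a fun k hk => by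
      obtain ⟨k, rfl⟩ := Nat.exists_eq_add_of_le' hk
      exact htr _ (hpow a ha k)
  let L : LieSubalgebra ℂ (Module.End ℂ V) :=
    { S with
      lie_mem' := fun {a b} ha hb => by
        rw [LieRing.of_associative_ring_bracket]
        exact sub_mem (hmul _ ha _ hb) (hmul _ hb _ ha) }
  have hL : LieModule.IsNilpotent L V := by
    rw [LieModule.isNilpotent_iff_forall' (R := ℂ)]
    intro x
    exact hnil x.1 x.2
  have := LieModule.nontrivial_max_triv_of_isNilpotent ℂ L V
  obtain ⟨⟨v, hv⟩, hv0⟩ := exists_ne (0 : LieModule.maxTrivSubmodule ℂ L V)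
  refine ⟨v, fun h => hv0 (Subtype.ext h), fun u hu => ?_⟩
  have h := (LieModule.mem_maxTrivSubmodule ℂ L V v).1 hv
    ⟨u - 1, Submodule.subset_span ⟨u, hu, rfl⟩⟩
  change (u - 1) v = 0 at h
  simpa [sub_eq_zero] using h

end Trace

/-- A subgroup of `GL(V)` that is closed under adjoints for a Hermitian inner product is
reductive. -/
theorem isReductiveSubgroup_of_adjoint {V : Type*} [NormedAddCommGroup V]
    [InnerProductSpace ℂ V] [FiniteDimensional ℂ V]
    (H : Subgroup (LinearMap.GeneralLinearGroup ℂ V))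
    (hH : ∀ h ∈ H, ∃ h' ∈ H, ∀ x y : V,
      inner ℂ x ((h : Module.End ℂ V) y) = inner ℂ ((h' : Module.End ℂ V) x) y) :
    IsReductiveSubgroup H := by
  intro U hUH hnorm hunip
  -- The fixed space of `U`. It is `H`-stable because `U` is normal, so its orthogonal complement is
  -- stable under adjoints of `H`, which again lie in `H`. Kolchin's theorem on a nonzero complement
  -- would give a vector in `W ∩ Wᗮ`.
  let W : Submodule ℂ V :=
    { carrier := {v | ∀ u ∈ U, (u : Module.End ℂ V) v = v}
      zero_mem' := fun u _ => map_zero _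
      add_mem' := fun ha hb u hu => by rw [map_add, ha u hu, hb u hu]
      smul_mem' := fun c x hx u hu => by rw [map_smul, hx u hu] }
  have hWH : ∀ h ∈ H, ∀ w ∈ W, (h : Module.End ℂ V) w ∈ W := by
    intro h hh w hw u hu
    have h1 := hw _ (hnorm h⁻¹ (inv_mem hh) u hu)
    rw [inv_inv] at h1
    have h2 : (u : Module.End ℂ V) ((h : Module.End ℂ V) w) =
        (h : Module.End ℂ V) (((h⁻¹ * u * h : LinearMap.GeneralLinearGroup ℂ V) :
          Module.End ℂ V) w) := by
      simp only [← Module.End.mul_apply, ← Units.val_mul]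
      congr 2
      group
    rw [h2, h1]
  have hWperp : ∀ u ∈ U, ∀ y ∈ Wᗮ, (u : Module.End ℂ V) y ∈ Wᗮ := by
    intro u hu y hy
    rw [Submodule.mem_orthogonal] at hy ⊢
    intro w hw
    obtain ⟨h', hh', hadj⟩ := hH u (hUH hu)
    rw [hadj]
    exact hy _ (hWH h' hh' w hw)
  have hbot : Wᗮ = ⊥ := by
    by_contra hne
    have : Nontrivial Wᗮ := Submodule.nontrivial_iff_ne_bot.2 hne
    let U' : Submonoid (Module.End ℂ Wᗮ) :=
      { carrier := {f | ∃ u ∈ U, ∀ w : Wᗮ, (f w : V) = (u : Module.End ℂ V) w}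
        one_mem' := ⟨1, one_mem _, fun w => by simp⟩
        mul_mem' := by
          rintro f g ⟨u, hu, hf⟩ ⟨v, hv, hg⟩
          exact ⟨u * v, mul_mem hu hv, fun w => by simp [hf, hg]⟩ }
    obtain ⟨v, hv0, hv⟩ := exists_fixed_vector U' (by
      rintro f ⟨u, hu, hf⟩
      obtain ⟨n, hn⟩ := hunip u hu
      refine ⟨n, ?_⟩
      have : ∀ (k : ℕ) (w : Wᗮ), (((f - 1) ^ k) w : V) = (((u : Module.End ℂ V) - 1) ^ k) w := by
        intro k
        induction k with
        | zero => intro w; simp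
        | succ k ih => intro w; simp [pow_succ, ih, hf]
      ext w
      rw [this, hn]; simp)
    have hvW : (v : V) ∈ W := by
      intro u hu
      have := hv ((u : Module.End ℂ V).restrict (hWperp u hu)) ⟨u, hu, fun w => rfl⟩
      exact congrArg Subtype.val this
    apply hv0
    have h0 := (Submodule.mem_orthogonal _ _).1 v.2 v hvW
    exact Subtype.ext (inner_self_eq_zero.1 h0)
  have htop : W = ⊤ := (Submodule.orthogonal_eq_bot_iff).1 hbot
  rw [eq_bot_iff]
  intro u hu
  rw [Subgroup.mem_bot]
  ext v
  have : v ∈ W := htop ▸ Submodule.mem_top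
  simpa using this u hu

/-- In a commutative finite-dimensional complex algebra every invertible element is an
exponential. -/
theorem exists_exp_eq_of_isUnit {E : Type*} [NormedRing E] [NormedAlgebra ℂ E]
    [FiniteDimensional ℂ E] (hcomm : ∀ a b : E, Commute a b) {u : E} (hu : IsUnit u) :
    ∃ x : E, NormedSpace.exp x = u := by
  have _ : CompleteSpace E := FiniteDimensional.complete ℂ E
  let _ : NormedAlgebra ℚ E := NormedAlgebra.restrictScalars ℚ ℂ E
  have hnhds : Set.range (NormedSpace.exp : E → E) ∈ nhds (1 : E) := by
    have h := (hasStrictFDerivAt_exp_zero (𝕂 := ℂ) (𝔸 := E)).map_nhds_eq_of_surj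
      (by rw [LinearMap.range_eq_top]; exact fun x => ⟨x, rfl⟩)
    rw [NormedSpace.exp_zero] at h
    rw [← h]
    exact Filter.mem_map.2 (Filter.univ_mem' fun x => ⟨x, rfl⟩)
  -- The complex line joining `1` to `u`. It leaves the units at only finitely many parameters,
  -- because the spectrum of `u` is finite, and removing a countable set leaves the complex plane
  -- connected.
  let f : ℂ → E := fun z => 1 + z • (u - 1)
  have hf : Continuous f := by fun_prop
  let D : Set ℂ := {z | IsUnit (f z)}
  have hfin : (spectrum ℂ u).Finite := by
    have h := Module.End.finite_spectrum (LinearMap.mulLeft ℂ u)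
    refine h.subset fun z hz => ?_
    rw [spectrum.mem_iff] at hz ⊢
    contrapose! hz
    have hinj : Function.Injective (LinearMap.mulLeft ℂ (algebraMap ℂ E z - u)) := by
      have := (Module.End.isUnit_iff _).1 hz
      convert this.1 using 2
      ext x; simp [sub_mul, Algebra.smul_def]
    obtain ⟨x, hx⟩ := (LinearMap.injective_iff_surjective.1 hinj) 1
    have hx' : (algebraMap ℂ E z - u) * x = 1 := hx
    exact ⟨⟨_, x, hx', (hcomm _ _).eq.trans hx'⟩, rfl⟩
  have hD : IsPreconnected D := by
    have hc : (Dᶜ).Countable := by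
      refine Set.Finite.countable ((hfin.image fun w => (1 - w)⁻¹).subset ?_)
      intro z hz
      have hz0 : z ≠ 0 := by
        rintro rfl
        exact hz (by simp [D, f])
      refine ⟨1 - z⁻¹, ?_, by simp⟩
      rw [spectrum.mem_iff]
      intro hun
      apply hz
      have : f z = (-z) • (algebraMap ℂ E (1 - z⁻¹) - u) := by
        simp only [f, Algebra.algebraMap_eq_smul_one, sub_smul, smul_sub, neg_smul, one_smul]
        rw [smul_inv_smul₀ hz0]
        abel
      change IsUnit (f z)
      rw [this]
      exact (hun.smul (Units.mk0 (-z) (neg_ne_zero.2 hz0)))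
    have := hc.isConnected_compl_of_one_lt_rank (by rw [Complex.rank_real_complex]; norm_num)
    rw [compl_compl] at this
    exact this.isPreconnected
  -- Being an exponential is locally constant along the units: nearby values differ by a factor
  -- close to `1`, which is an exponential by the inverse function theorem, and commutativity lets
  -- exponentials be multiplied.
  have hloc : ∀ z ∈ D, ∀ᶠ w in nhds z, (∃ x, NormedSpace.exp x = f w) ↔
      ∃ x, NormedSpace.exp x = f z := by
    intro z hz
    obtain ⟨c, hc⟩ := hz
    have ht : Filter.Tendsto (fun w => f w * ((c⁻¹ : Eˣ) : E)) (nhds z) (nhds 1) := by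
      have : f z * ((c⁻¹ : Eˣ) : E) = 1 := by rw [← hc]; simp
      rw [← this]
      exact (hf.mul continuous_const).tendsto z
    filter_upwards [ht hnhds] with w hw
    obtain ⟨y, hy⟩ := hw
    have hfw : f w = NormedSpace.exp y * f z := by rw [hy, ← hc]; simp
    constructor
    · rintro ⟨x, hx⟩
      refine ⟨-y + x, ?_⟩
      rw [NormedSpace.exp_add_of_commute (hcomm _ _), hx, hfw, ← mul_assoc,
        ← NormedSpace.exp_add_of_commute (hcomm _ _)]
      simp
    · rintro ⟨x, hx⟩
      exact ⟨y + x, by rw [NormedSpace.exp_add_of_commute (hcomm _ _), hx, hfw]⟩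
  have h1 : (1 : ℂ) ∈ D := by simpa [D, f] using hu
  have h0 : (0 : ℂ) ∈ D := by simp [D, f]
  have := hD.induction₂ (fun z w => (∃ x, NormedSpace.exp x = f w) ↔ ∃ x, NormedSpace.exp x = f z)
    (fun z hz => (hloc z hz).filter_mono nhdsWithin_le_nhds)
    (fun x y z _ _ _ h1 h2 => h2.trans h1) (fun x y _ _ h => h.symm) h0 h1
  obtain ⟨x, hx⟩ := this.2 ⟨0, by simp [f]⟩
  exact ⟨x, by simpa [f] using hx⟩

/-! ### Exponentials and logarithms of complex matrices -/

section MatrixExp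

variable {N : Type*} [Fintype N] [DecidableEq N]

theorem hasSum_matrix_exp (x : Matrix N N ℂ) :
    HasSum (fun n : ℕ => ((n.factorial : ℂ)⁻¹) • x ^ n) (NormedSpace.exp x) := by
  let _ : NormedRing (Matrix N N ℂ) := Matrix.linftyOpNormedRing
  let _ : NormedAlgebra ℂ (Matrix N N ℂ) := Matrix.linftyOpNormedAlgebra
  have _ : CompleteSpace (Matrix N N ℂ) := FiniteDimensional.complete ℂ _
  exact NormedSpace.exp_series_hasSum_exp' (𝕂 := ℂ) x

theorem exp_mem_of_pow_mem {s : Submodule ℂ (Matrix N N ℂ)} {x : Matrix N N ℂ}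
    (h : ∀ n, x ^ n ∈ s) : NormedSpace.exp x ∈ s :=
  s.closed_of_finiteDimensional.mem_of_tendsto (hasSum_matrix_exp x)
    (Filter.Eventually.of_forall fun _ => sum_mem fun n _ => s.smul_mem _ (h n))

theorem exp_mem_subalgebra {s : Subalgebra ℂ (Matrix N N ℂ)} {x : Matrix N N ℂ}
    (h : x ∈ s) : NormedSpace.exp x ∈ s :=
  exp_mem_of_pow_mem (s := Subalgebra.toSubmodule s) fun n => pow_mem h n

/-- Every invertible complex matrix has a logarithm which is a polynomial in the matrix. -/
theorem exists_matrix_log {G : Matrix N N ℂ} (hG : IsUnit G) :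
    ∃ x ∈ Algebra.adjoin ℂ {G}, NormedSpace.exp x = G := by
  let _ : NormedRing (Matrix N N ℂ) := Matrix.linftyOpNormedRing
  let _ : NormedAlgebra ℂ (Matrix N N ℂ) := Matrix.linftyOpNormedAlgebra
  let E := Algebra.adjoin ℂ {G}
  let _ : NormedAlgebra ℚ E := NormedAlgebra.restrictScalars ℚ ℂ E
  let _ : NormedAlgebra ℚ (Matrix N N ℂ) := NormedAlgebra.restrictScalars ℚ ℂ (Matrix N N ℂ)
  have hcomm : ∀ a b : E, Commute a b := by
    rintro ⟨a, ha⟩ ⟨b, hb⟩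
    apply Subtype.ext
    exact Algebra.commute_of_mem_adjoin_of_forall_mem_commute hb (fun c hc => by
      rw [Set.mem_singleton_iff.1 hc]
      exact Commute.symm (Algebra.commute_of_mem_adjoin_singleton_of_commute ha rfl))
  let u : E := ⟨G, Algebra.self_mem_adjoin_singleton ℂ G⟩
  -- The inverse of `G` lies in the algebra generated by `G`: multiplication by `G` is injective
  -- there, hence surjective by finite dimension.
  have hu : IsUnit u := by
    have hinj : Function.Injective (LinearMap.mulLeft ℂ u) := by
      intro a b hab
      apply Subtype.ext
      exact hG.mul_left_cancel (congrArg Subtype.val hab)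
    obtain ⟨x, hx⟩ := (LinearMap.injective_iff_surjective.1 hinj) 1
    exact ⟨⟨u, x, hx, (hcomm _ _).eq.trans hx⟩, rfl⟩
  obtain ⟨x, hx⟩ := exists_exp_eq_of_isUnit hcomm hu
  refine ⟨x.1, x.2, ?_⟩
  have := NormedSpace.map_exp (E.val : E →ₐ[ℂ] Matrix N N ℂ) continuous_subtype_val x
  rw [hx] at this
  exact this.symm

end MatrixExp

/-! ### Coadjoint stabilisers in connected matrix groups -/

section Coadjoint

variable {N : Type*} [Fintype N] [DecidableEq N] {q : LieSubalgebra ℂ (Matrix N N ℂ)}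

/-- The curve `s ↦ exp(sx) y exp(-sx)` stays in `q`, and its derivative is its commutator with `x`.
Thus `φ` has derivative zero along the curve and is constant. -/
theorem apply_exp_conj_eq (φ : Matrix N N ℂ →ₗ[ℂ] ℂ) {x y : Matrix N N ℂ} (hx : x ∈ q)
    (hy : y ∈ q) (h : ∀ z ∈ q, φ (x * z - z * x) = 0) :
    φ (NormedSpace.exp x * y * NormedSpace.exp (-x)) = φ y := by
  let _ : NormedRing (Matrix N N ℂ) := Matrix.linftyOpNormedRing
  let _ : NormedAlgebra ℂ (Matrix N N ℂ) := Matrix.linftyOpNormedAlgebra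
  have _ : CompleteSpace (Matrix N N ℂ) := FiniteDimensional.complete ℂ _
  let φ' : Matrix N N ℂ →L[ℂ] ℂ := LinearMap.toContinuousLinearMap φ
  let G : ℂ → Matrix N N ℂ := fun s =>
    NormedSpace.exp (s • x) * y * NormedSpace.exp (s • (-x))
  have hG : ∀ s, HasDerivAt G (x * G s - G s * x) s := by
    intro s
    have h1 := hasDerivAt_exp_smul_const' (𝕂 := ℂ) x s
    have h2 := hasDerivAt_exp_smul_const (𝕂 := ℂ) (-x) s
    have := (h1.mul_const y).mul h2
    refine this.congr_deriv ?_
    change _ = x * (NormedSpace.exp (s • x) * y * NormedSpace.exp (s • (-x))) -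
      (NormedSpace.exp (s • x) * y * NormedSpace.exp (s • (-x))) * x
    noncomm_ring
  have hd : ∀ s, HasDerivAt (fun s => φ' (G s)) 0 s := by
    intro s
    have h1 := φ'.hasFDerivAt.comp_hasDerivAt s (hG s)
    have hmem : G s ∈ q := by
      have := exp_conj_mem q (q.smul_mem s hx) hy
      simpa [G, smul_neg] using this
    have h2 : φ' (x * G s - G s * x) = 0 := h _ hmem
    exact h1.congr_deriv h2
  have hconst := is_const_of_deriv_eq_zero (fun s => (hd s).differentiableAt)
    (fun s => (hd s).deriv) 1 0
  simpa [G, φ'] using hconst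

/-- The exponential of an element of `q`, as an element of the connected group of `q`. -/
noncomputable def expGroup (q : LieSubalgebra ℂ (Matrix N N ℂ)) {x : Matrix N N ℂ} (hx : x ∈ q) :
    connectedGroup q :=
  ⟨(Matrix.isUnit_exp x).unit, Subgroup.subset_closure ⟨x, hx, rfl⟩⟩

@[simp]
theorem expGroup_val {x : Matrix N N ℂ} (hx : x ∈ q) :
    ((expGroup q hx).1 : Matrix N N ℂ) = NormedSpace.exp x := rfl

@[simp]
theorem expGroup_inv_val {x : Matrix N N ℂ} (hx : x ∈ q) :
    (((expGroup q hx).1⁻¹ : GL N ℂ) : Matrix N N ℂ) = NormedSpace.exp (-x) := by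
  rw [Matrix.coe_units_inv, expGroup_val, Matrix.exp_neg]

@[simp]
theorem Ad_apply_val (g : connectedGroup q) (x : q) :
    (Ad q g x : Matrix N N ℂ) = (g.1 : Matrix N N ℂ) * x.1 * (g.1⁻¹ : GL N ℂ) := rfl

theorem Ad_lie (g : connectedGroup q) (x y : q) : Ad q g ⁅x, y⁆ = ⁅Ad q g x, Ad q g y⁆ := by
  ext1
  have h : ((g.1⁻¹ : GL N ℂ) : Matrix N N ℂ) * (g.1 : Matrix N N ℂ) = 1 := g.1.inv_mul
  simp only [Ad_apply_val, LieSubalgebra.coe_bracket, LieRing.of_associative_ring_bracket]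
  calc _ = (g.1 : Matrix N N ℂ) * x.1 * 1 * y.1 * (g.1⁻¹ : GL N ℂ) -
        (g.1 : Matrix N N ℂ) * y.1 * 1 * x.1 * (g.1⁻¹ : GL N ℂ) := by noncomm_ring
    _ = _ := by rw [← h]; noncomm_ring

@[simp]
theorem Ad_dual_apply (g : connectedGroup q) (γ : Module.Dual ℂ q) (x : q) :
    (Ad q).dual g γ x = γ (Ad q g⁻¹ x) := rfl

theorem Ad_Ad_inv (g : connectedGroup q) (x : q) : Ad q g (Ad q g⁻¹ x) = x := by
  rw [← Module.End.mul_apply, ← map_mul, mul_inv_cancel, map_one, Module.End.one_apply]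

theorem Ad_inv_Ad (g : connectedGroup q) (x : q) : Ad q g⁻¹ (Ad q g x) = x := by
  rw [← Module.End.mul_apply, ← map_mul, inv_mul_cancel, map_one, Module.End.one_apply]

theorem mem_groupStabiliser {γ : Module.Dual ℂ q} {g : connectedGroup q} :
    g ∈ groupStabiliser q γ ↔ ∀ x, γ (Ad q g x) = γ x := by
  change (Ad q).dual g γ = γ ↔ _
  constructor
  · intro h x
    rw [← h, Ad_dual_apply, Ad_inv_Ad, h]
  · intro h
    ext x
    rw [Ad_dual_apply, ← h, Ad_Ad_inv]

theorem mem_lieStabiliser {γ : Module.Dual ℂ q} {x : q} :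
    x ∈ lieStabiliser q γ ↔ ∀ y : q, γ ⁅x, y⁆ = 0 := Iff.rfl

theorem Ad_mem_lieStabiliser_dual {γ : Module.Dual ℂ q} {g : connectedGroup q} {x : q} :
    Ad q g x ∈ lieStabiliser q ((Ad q).dual g γ) ↔ x ∈ lieStabiliser q γ := by
  simp only [mem_lieStabiliser, Ad_dual_apply, Ad_lie, Ad_inv_Ad]
  constructor
  · intro h y
    simpa [Ad_inv_Ad] using h (Ad q g y)
  · intro h y
    exact h _

theorem lieStabiliser_dual (γ : Module.Dual ℂ q) (g : connectedGroup q) :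
    (lieStabiliser q ((Ad q).dual g γ)).toSubmodule =
      (lieStabiliser q γ).toSubmodule.map (Ad q g) := by
  ext x
  rw [Submodule.mem_map]
  constructor
  · intro hx
    refine ⟨Ad q g⁻¹ x, ?_, Ad_Ad_inv g x⟩
    rw [← Ad_Ad_inv g x] at hx
    exact Ad_mem_lieStabiliser_dual.1 hx
  · rintro ⟨y, hy, rfl⟩
    exact Ad_mem_lieStabiliser_dual.2 hy

theorem Ad_mem_lieStabiliser {γ : Module.Dual ℂ q} {g : connectedGroup q}
    (hg : g ∈ groupStabiliser q γ) {x : q} (hx : x ∈ lieStabiliser q γ) :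
    Ad q g x ∈ lieStabiliser q γ := by
  have h := (Ad_mem_lieStabiliser_dual (g := g)).2 hx
  rwa [show (Ad q).dual g γ = γ from hg] at h

theorem IsOfNilpotentType.dual {γ : Module.Dual ℂ q} (hγ : IsOfNilpotentType q γ)
    (g : connectedGroup q) : IsOfNilpotentType q ((Ad q).dual g γ) := by
  intro x hx
  rw [← Ad_Ad_inv g x] at hx
  exact hγ _ (Ad_mem_lieStabiliser_dual.1 hx)

theorem IsReductiveSubgroup.conj {V : Type*} [AddCommGroup V] [Module ℂ V]
    {H H' : Subgroup (LinearMap.GeneralLinearGroup ℂ V)} (hH : IsReductiveSubgroup H)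
    (a : LinearMap.GeneralLinearGroup ℂ V) (h : ∀ x, x ∈ H' ↔ a⁻¹ * x * a ∈ H) :
    IsReductiveSubgroup H' := by
  intro U hU hn hu
  have key := hH (U.comap (MulAut.conj a).toMonoidHom) ?_ ?_ ?_
  · rw [eq_bot_iff] at key ⊢
    intro u huU
    have hmem : a⁻¹ * u * a ∈ U.comap (MulAut.conj a).toMonoidHom := by
      simpa [Subgroup.mem_comap, mul_assoc] using huU
    have h1 : a⁻¹ * u * a = 1 := key hmem
    rw [Subgroup.mem_bot]
    calc u = a * (a⁻¹ * u * a) * a⁻¹ := by group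
      _ = 1 := by rw [h1]; group
  · intro x hx
    have := (h _).1 (hU hx)
    simpa [mul_assoc] using this
  · intro x hx u hu'
    have h1 : a * x * a⁻¹ ∈ H' := (h _).2 (by simpa [mul_assoc] using hx)
    have h2 := hn _ h1 _ hu'
    simpa [Subgroup.mem_comap, mul_assoc] using h2
  · intro u hu'
    obtain ⟨n, hn⟩ := hu _ hu'
    refine ⟨n, ?_⟩
    have h0 : ((u : Module.End ℂ V) - 1) =
        (↑a⁻¹ : Module.End ℂ V) * ((((MulAut.conj a).toMonoidHom u : LinearMap.GeneralLinearGroup ℂ V) :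
          Module.End ℂ V) - 1) * (a : Module.End ℂ V) := by
      simp [mul_sub, sub_mul, mul_assoc]
    have h1 := Units.conj_pow' a ((((MulAut.conj a).toMonoidHom u :
      LinearMap.GeneralLinearGroup ℂ V) : Module.End ℂ V) - 1) n
    rw [h0]
    refine h1.trans ?_
    rw [hn]
    simp

theorem IsOfReductiveType.dual {γ : Module.Dual ℂ q} (hγ : IsOfReductiveType q γ)
    (g : connectedGroup q) : IsOfReductiveType q ((Ad q).dual g γ) := by
  refine IsReductiveSubgroup.conj hγ ((Ad q).toHomUnits g) fun x => ?_
  have hmem : ∀ k : connectedGroup q, k ∈ groupStabiliser q ((Ad q).dual g γ) ↔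
      g⁻¹ * k * g ∈ groupStabiliser q γ := by
    intro k
    change (Ad q).dual k ((Ad q).dual g γ) = (Ad q).dual g γ ↔ (Ad q).dual (g⁻¹ * k * g) γ = γ
    rw [map_mul, map_mul, Module.End.mul_apply, Module.End.mul_apply]
    constructor
    · intro h
      rw [h, ← Module.End.mul_apply, ← map_mul, inv_mul_cancel, map_one, Module.End.one_apply]
    · intro h
      conv_rhs => rw [← h]
      rw [← Module.End.mul_apply _ ((Ad q).dual g⁻¹), ← map_mul, mul_inv_cancel, map_one,
        Module.End.one_apply]
  constructor
  · rintro ⟨k, hk, rfl⟩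
    exact ⟨_, (hmem k).1 hk, by simp⟩
  · rintro ⟨k, hk, hkx⟩
    refine ⟨g * k * g⁻¹, (hmem _).2 (by simpa [mul_assoc] using hk), ?_⟩
    rw [map_mul, map_mul, hkx, map_inv]
    group

/-- The inclusion of `exp(q_γ)` in `Q_γ` is the only link between the two stabilisers that the proof
needs. Extending `γ` to all matrices permits differentiation in the full matrix algebra. -/
theorem expGroup_mem_groupStabiliser {γ : Module.Dual ℂ q} {x : q}
    (hx : x ∈ lieStabiliser q γ) : expGroup q x.2 ∈ groupStabiliser q γ := by
  obtain ⟨φ, hφ⟩ := LinearMap.exists_extend (p := q.toSubmodule) γ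
  have hφ' : ∀ z : q, φ z.1 = γ z := fun z => LinearMap.congr_fun hφ z
  rw [mem_groupStabiliser]
  intro y
  rw [← hφ', ← hφ', Ad_apply_val, expGroup_val, expGroup_inv_val]
  refine apply_exp_conj_eq φ x.2 y.2 fun z hz => ?_
  rw [← mem_lieStabiliser.1 hx ⟨z, hz⟩, ← hφ']
  rfl

theorem isNilpotent_exp_sub_one {x : Matrix N N ℂ} (hx : IsNilpotent x) :
    IsNilpotent (NormedSpace.exp x - 1) := by
  have h : NormedSpace.exp x = IsNilpotent.exp x := by
    refine (hasSum_matrix_exp x).unique ?_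
    obtain ⟨k, hk⟩ := hx
    rw [IsNilpotent.exp_eq_sum hk]
    have : ∀ n, ((n.factorial : ℚ)⁻¹) • x ^ n = ((n.factorial : ℂ)⁻¹) • x ^ n := by
      intro n
      rw [← Rat.cast_smul_eq_qsmul ℂ]
      simp
    simp only [this]
    refine hasSum_sum_of_ne_finset_zero fun n hn => ?_
    rw [pow_eq_zero_of_le (by simpa using hn) hk, smul_zero]
  rw [h]
  exact IsNilpotent.isNilpotent_exp_sub_one hx

/-- With `L` and `R` the left and right multiplications by `g - 1` and `g⁻¹ - 1`, one has `Ad g - 1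
= (L + 1)(R + 1) - 1 = L(R + 1) + R`, and `L`, `R` are commuting nilpotents. -/
theorem isNilpotent_Ad_sub_one {g : connectedGroup q}
    (h : IsNilpotent ((g.1 : Matrix N N ℂ) - 1))
    (h' : IsNilpotent (((g.1⁻¹ : GL N ℂ) : Matrix N N ℂ) - 1)) :
    IsNilpotent (Ad q g - 1) := by
  set L := LinearMap.mulLeft ℂ ((g.1 : Matrix N N ℂ) - 1)
  set R := LinearMap.mulRight ℂ (((g.1⁻¹ : GL N ℂ) : Matrix N N ℂ) - 1)
  have hc : Commute L R := LinearMap.commute_mulLeft_right _ _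
  have hL : IsNilpotent L := by
    obtain ⟨n, hn⟩ := h
    exact ⟨n, by rw [LinearMap.pow_mulLeft, hn]; simp⟩
  have hR : IsNilpotent R := by
    obtain ⟨n, hn⟩ := h'
    exact ⟨n, by rw [LinearMap.pow_mulRight, hn]; simp⟩
  have hS : IsNilpotent (L * (R + 1) + R) := by
    refine Commute.isNilpotent_add ?_ (Commute.isNilpotent_mul_right ?_ hL) hR
    · exact Commute.mul_left hc ((Commute.refl R).add_left (Commute.one_left R))
    · exact hc.add_right (Commute.one_right L)
  obtain ⟨n, hn⟩ := hS
  have hpow : ∀ (k : ℕ) (x : q),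
      (((Ad q g - 1) ^ k) x : Matrix N N ℂ) = ((L * (R + 1) + R) ^ k) x.1 := by
    intro k
    induction k with
    | zero => intro x; simp
    | succ k ih =>
      intro x
      rw [pow_succ, pow_succ, Module.End.mul_apply, Module.End.mul_apply, ih]
      congr 1
      simp [L, R, sub_mul, mul_sub]
      noncomm_ring
  refine ⟨n, ?_⟩
  ext x : 2
  rw [hpow, hn]
  simp

/-- If `γ` is of reductive type, then every space of commuting nilpotent matrices in `q_γ` that is
stable under `Q_γ` is central in `q`. -/
theorem IsOfReductiveType.commute_of_nilpotent {γ : Module.Dual ℂ q}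
    (hγ : IsOfReductiveType q γ) (c : Submodule ℂ q) (hc : ∀ x ∈ c, x ∈ lieStabiliser q γ)
    (hcomm : ∀ x ∈ c, ∀ y ∈ c, Commute x.1 y.1) (hnil : ∀ x ∈ c, IsNilpotent x.1)
    (hstab : ∀ g ∈ groupStabiliser q γ, ∀ x ∈ c, Ad q g x ∈ c) :
    ∀ x ∈ c, ∀ y ∈ q, x.1 * y = y * x.1 := by
  have hmul : ∀ x ∈ c, ∀ y ∈ c, expGroup q (x + y).2 = expGroup q x.2 * expGroup q y.2 := by
    intro x hx y hy
    apply Subtype.ext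
    apply Units.ext
    exact Matrix.exp_add_of_commute _ _ (hcomm x hx y hy)
  -- Since the elements of `c` commute, their exponentials form a group. Its image under `Ad` is
  -- unipotent and normal in the image of `Q_γ`, so reductive type makes it trivial.
  let U : Subgroup (LinearMap.GeneralLinearGroup ℂ q) :=
    { carrier := {u | ∃ x ∈ c, u = (Ad q).toHomUnits (expGroup q x.2)}
      one_mem' := ⟨0, c.zero_mem, by
        have : expGroup q (0 : q).2 = 1 := by
          apply Subtype.ext; apply Units.ext
          exact NormedSpace.exp_zero
        rw [this, map_one]⟩
      mul_mem' := by
        rintro _ _ ⟨x, hx, rfl⟩ ⟨y, hy, rfl⟩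
        exact ⟨x + y, c.add_mem hx hy, by rw [hmul x hx y hy, map_mul]⟩
      inv_mem' := by
        rintro _ ⟨x, hx, rfl⟩
        refine ⟨-x, c.neg_mem hx, ?_⟩
        rw [← map_inv]
        congr 1
        apply Subtype.ext; apply Units.ext
        exact expGroup_inv_val x.2 }
  have hU : U = ⊥ := by
    apply hγ
    · rintro _ ⟨x, hx, rfl⟩
      exact ⟨_, expGroup_mem_groupStabiliser (hc x hx), rfl⟩
    · rintro _ ⟨g, hg, rfl⟩ _ ⟨x, hx, rfl⟩
      refine ⟨Ad q g x, hstab g hg x hx, ?_⟩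
      rw [← map_inv, ← map_mul, ← map_mul]
      congr 1
      apply Subtype.ext; apply Units.ext
      exact (Matrix.exp_units_conj g.1 x.1).symm
    · rintro _ ⟨x, hx, rfl⟩
      refine isNilpotent_Ad_sub_one (isNilpotent_exp_sub_one (hnil x hx)) ?_
      rw [expGroup_inv_val]
      exact isNilpotent_exp_sub_one (hnil x hx).neg
  intro x hx y hy
  -- Triviality holds for every multiple of `x`, so the resulting identity can be differentiated at
  -- `s = 0`.
  have key : ∀ s : ℂ, NormedSpace.exp (s • x.1) * y = y * NormedSpace.exp (s • x.1) := by
    intro s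
    have h1 : (Ad q).toHomUnits (expGroup q (s • x).2) ∈ U := ⟨s • x, c.smul_mem s hx, rfl⟩
    rw [hU, Subgroup.mem_bot] at h1
    have h2 : Ad q (expGroup q (s • x).2) ⟨y, hy⟩ = ⟨y, hy⟩ := by
      have := congrArg (fun u : LinearMap.GeneralLinearGroup ℂ q => (u : Module.End ℂ q) ⟨y, hy⟩) h1
      simpa using this
    have h3 := congrArg Subtype.val h2
    rw [Ad_apply_val, expGroup_val] at h3
    have h4 := (expGroup q (s • x).2).1.inv_mul
    rw [expGroup_val] at h4
    change NormedSpace.exp ((s • x : q).1) * y = y * NormedSpace.exp ((s • x : q).1)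
    calc _ = NormedSpace.exp ((s • x : q).1) * y *
          (((expGroup q (s • x).2).1⁻¹ : GL N ℂ) * NormedSpace.exp ((s • x : q).1)) := by
            rw [h4, mul_one]
      _ = _ := by rw [← mul_assoc]; exact congrArg (· * _) h3
  let _ : NormedRing (Matrix N N ℂ) := Matrix.linftyOpNormedRing
  let _ : NormedAlgebra ℂ (Matrix N N ℂ) := Matrix.linftyOpNormedAlgebra
  have _ : CompleteSpace (Matrix N N ℂ) := FiniteDimensional.complete ℂ _
  have h1 := (hasDerivAt_exp_smul_const (𝕂 := ℂ) x.1 0).mul_const y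
  have h2 := (hasDerivAt_exp_smul_const (𝕂 := ℂ) x.1 0).const_mul y
  have h3 := (h1.congr_of_eventuallyEq (Filter.Eventually.of_forall fun s => (key s).symm)).unique h2
  rw [zero_smul, NormedSpace.exp_zero, one_mul] at h3
  exact h3

end Coadjoint

/-! ### Graded parabolic subalgebras of the symplectic Lie algebra -/

section Graded

variable {K : Type*} [Fintype K] [DecidableEq K]

/-- The grading of the symplectic basis in which the `e_k` have degree `lev k` and the `f_k` have
degree `2 t - lev k`. -/
def grade (lev : K → ℕ) (t : ℕ) : K ⊕ K → ℕ := Sum.elim lev fun k => 2 * t - lev k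

/-- `q` consists of the elements of `sp` that are upper block triangular for the grading. -/
structure IsGradedParabolic (lev : K → ℕ) (t : ℕ)
    (q : LieSubalgebra ℂ (Matrix (K ⊕ K) (K ⊕ K) ℂ)) : Prop where
  le : ∀ k, lev k ≤ t
  mem_iff : ∀ x, x ∈ q ↔ x ∈ LieAlgebra.Symplectic.sp K ℂ ∧ x.BlockTriangular (grade lev t)

theorem mem_sp_iff_mul {x : Matrix (K ⊕ K) (K ⊕ K) ℂ} :
    x ∈ LieAlgebra.Symplectic.sp K ℂ ↔ xᵀ * Matrix.J K ℂ = -(Matrix.J K ℂ * x) := by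
  rw [LieAlgebra.Symplectic.sp, mem_skewAdjointMatricesLieSubalgebra,
    mem_skewAdjointMatricesSubmodule]
  simp [Matrix.IsSkewAdjoint, Matrix.IsAdjointPair]

theorem mem_sp_iff {A B C D : Matrix K K ℂ} :
    fromBlocks A B C D ∈ LieAlgebra.Symplectic.sp K ℂ ↔ D = -Aᵀ ∧ Bᵀ = B ∧ Cᵀ = C := by
  rw [mem_sp_iff_mul]
  simp only [Matrix.J, fromBlocks_transpose, fromBlocks_multiply, fromBlocks_neg, fromBlocks_inj]
  simp
  constructor
  · rintro ⟨h1, h2, h3, h4⟩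
    exact ⟨by rw [h2], h4, h1⟩
  · rintro ⟨h1, h2, h3⟩
    exact ⟨h3, by rw [h1], by rw [h1]; simp, h2⟩

/-- If `x` is skew for the symplectic form, then `x²` is self-adjoint, so multiplying by it
preserves skewness for matrices commuting with it. This later supplies the elements of `q` against
which nilpotent type is tested. -/
theorem pow_odd_mem_sp {x : Matrix (K ⊕ K) (K ⊕ K) ℂ} (hx : x ∈ LieAlgebra.Symplectic.sp K ℂ)
    (i : ℕ) : x ^ (2 * i + 1) ∈ LieAlgebra.Symplectic.sp K ℂ := by
  rw [mem_sp_iff_mul] at *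
  induction i with
  | zero => simpa using hx
  | succ i ih =>
    have h1 : x ^ (2 * (i + 1) + 1) = x ^ (2 * i + 1) * (x * x) := by
      rw [← sq, ← pow_add]; congr 1
    have h2 : (x * x)ᵀ * Matrix.J K ℂ = Matrix.J K ℂ * (x * x) := by
      rw [transpose_mul, mul_assoc, hx, mul_neg, ← mul_assoc, hx, neg_mul, neg_neg, mul_assoc]
    have h3 : Commute (x ^ (2 * i + 1)) (x * x) := ((Commute.refl x).mul_right rfl).pow_left _
    rw [h1, h3.eq, transpose_mul, mul_assoc, h2, ← mul_assoc, ih, neg_mul, mul_assoc, h3.eq]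

/-- The idempotent projecting to the levels below `t`. -/
def levelProj (lev : K → ℕ) (t : ℕ) : Matrix K K ℂ := diagonal fun k => if lev k < t then 1 else 0

@[simp]
theorem levelProj_transpose (lev : K → ℕ) (t : ℕ) : (levelProj lev t)ᵀ = levelProj lev t :=
  diagonal_transpose _

theorem levelProj_mul_apply (lev : K → ℕ) (t : ℕ) (A : Matrix K K ℂ) (k l : K) :
    (levelProj lev t * A) k l = if lev k < t then A k l else 0 := by
  rw [levelProj, diagonal_mul]; split_ifs <;> simp

theorem mul_levelProj_apply (lev : K → ℕ) (t : ℕ) (A : Matrix K K ℂ) (k l : K) :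
    (A * levelProj lev t) k l = if lev l < t then A k l else 0 := by
  rw [levelProj, mul_diagonal]; split_ifs <;> simp

/-- The matrices `A`, `B`, `C` are the blocks of an element of the sum of the orthogonal algebras
of the levels below `t` and of the symplectic algebra of level `t`. -/
structure LevelSkew (lev : K → ℕ) (t : ℕ) (A B C : Matrix K K ℂ) : Prop where
  diag : ∀ k l, lev k ≠ lev l → A k l = 0
  skew : ∀ k l, lev k < t → A l k = -A k l
  symmB : Bᵀ = B
  symmC : Cᵀ = C
  zeroB : ∀ k l, lev k < t → B k l = 0
  zeroC : ∀ k l, lev k < t → C k l = 0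

variable {lev : K → ℕ} {t : ℕ} {q : LieSubalgebra ℂ (Matrix (K ⊕ K) (K ⊕ K) ℂ)}

/-- Every `e_k` has degree at most `t` and every `f_k` degree at least `t`. Hence `B` is constrained
only by symmetry, while `C` survives only on level `t`, where both degrees equal `t`. -/
theorem IsGradedParabolic.mem_iff_blocks (hq : IsGradedParabolic lev t q) {A B C D : Matrix K K ℂ} :
    fromBlocks A B C D ∈ q ↔ D = -Aᵀ ∧ Bᵀ = B ∧ Cᵀ = C ∧ A.BlockTriangular lev ∧
      ∀ k l, lev k < t → C k l = 0 := by
  have hle := hq.le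
  rw [hq.mem_iff, mem_sp_iff]
  constructor
  · rintro ⟨⟨h1, h2, h3⟩, h⟩
    refine ⟨h1, h2, h3, fun k l hkl => h (i := Sum.inl k) (j := Sum.inl l) hkl, fun k l hk => ?_⟩
    refine h (i := Sum.inr k) (j := Sum.inl l) ?_
    have := hle l
    simp only [grade, Sum.elim_inl, Sum.elim_inr]
    omega
  · rintro ⟨h1, h2, h3, h4, h5⟩
    refine ⟨⟨h1, h2, h3⟩, ?_⟩
    rintro (k | k) (l | l) hkl <;> simp only [grade, Sum.elim_inl, Sum.elim_inr] at hkl <;>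
      have hk := hle k <;> have hl := hle l
    · exact h4 hkl
    · omega
    · simp only [fromBlocks_apply₂₁]
      rcases lt_or_ge (lev k) t with h | h
      · exact h5 k l h
      · have := h5 l k (by omega)
        rw [← h3]; exact this
    · have h6 : A l k = 0 := h4 (show lev k < lev l by omega)
      simp [h1, h6]

theorem IsGradedParabolic.exists_blocks (hq : IsGradedParabolic lev t q)
    {x : Matrix (K ⊕ K) (K ⊕ K) ℂ} (hx : x ∈ q) : ∃ A B C, x = fromBlocks A B C (-Aᵀ) ∧
      Bᵀ = B ∧ Cᵀ = C ∧ A.BlockTriangular lev ∧ ∀ k l, lev k < t → C k l = 0 := by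
  obtain ⟨A, B, C, D, rfl⟩ : ∃ A B C D, x = fromBlocks A B C D :=
    ⟨_, _, _, _, (fromBlocks_toBlocks x).symm⟩
  obtain ⟨h1, h⟩ := hq.mem_iff_blocks.1 hx
  exact ⟨A, B, C, by rw [h1], h⟩

/-- The linear form `x ↦ tr (ζ x)`. -/
def tracePairing {N : Type*} [Fintype N] [DecidableEq N] (q : LieSubalgebra ℂ (Matrix N N ℂ))
    (ζ : Matrix N N ℂ) : Module.Dual ℂ q where
  toFun x := trace (ζ * x.1)
  map_add' x y := by simp [mul_add]
  map_smul' c x := by simp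

/-! ### Linear forms as trace pairings -/

section TracePairing

variable {N : Type*} [Fintype N] [DecidableEq N] {q : LieSubalgebra ℂ (Matrix N N ℂ)}

theorem tracePairing_apply (ζ : Matrix N N ℂ) (x : q) :
    tracePairing q ζ x = trace (ζ * x.1) := rfl

theorem dual_tracePairing (g : connectedGroup q) (ζ : Matrix N N ℂ) :
    (Ad q).dual g (tracePairing q ζ) =
      tracePairing q ((g.1 : Matrix N N ℂ) * ζ * (g.1⁻¹ : GL N ℂ)) := by
  ext x
  rw [Ad_dual_apply, tracePairing_apply, tracePairing_apply, Ad_apply_val, Subgroup.coe_inv,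
    inv_inv, ← mul_assoc, trace_mul_comm]
  simp only [mul_assoc]

theorem tracePairing_lie (ζ : Matrix N N ℂ) (x y : q) :
    tracePairing q ζ ⁅x, y⁆ = trace ((ζ * x.1 - x.1 * ζ) * y.1) := by
  rw [tracePairing_apply, LieSubalgebra.coe_bracket, LieRing.of_associative_ring_bracket, mul_sub,
    sub_mul, trace_sub, trace_sub, mul_assoc, mul_assoc x.1, trace_mul_comm x.1, mul_assoc]

theorem exists_eq_tracePairing (γ : Module.Dual ℂ q) : ∃ ζ, γ = tracePairing q ζ := by
  obtain ⟨φ, hφ⟩ := LinearMap.exists_extend (p := q.toSubmodule) γ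
  refine ⟨Matrix.of fun i j => φ (single j i 1), ?_⟩
  ext x
  have hx : γ x = φ x.1 := (LinearMap.congr_fun hφ x).symm
  rw [hx, tracePairing_apply]
  conv_lhs => rw [matrix_eq_sum_single x.1]
  simp only [trace, diag_apply, mul_apply, of_apply, map_sum]
  rw [Finset.sum_comm]
  refine Finset.sum_congr rfl fun i _ => Finset.sum_congr rfl fun j _ => ?_
  rw [← mul_one (x.1 j i), ← smul_eq_mul, ← smul_single, map_smul]
  simp [mul_comm]

end TracePairing

theorem trace_fromBlocks_eq (A B C D : Matrix K K ℂ) :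
    trace (fromBlocks A B C D) = trace A + trace D := by
  simp [trace, Fintype.sum_sum_type]

/-- The pairing matches `S` with `B`, `Y` with `C` and `X` with `A`. As `B` is an arbitrary
symmetric matrix in the parabolic, the form sees all of `S`, but only parts of `X` and `Y`. -/
theorem trace_fromBlocks_mul (X Y S A B C : Matrix K K ℂ) :
    trace (fromBlocks X Y S (-Xᵀ) * fromBlocks A B C (-Aᵀ)) =
      2 * trace (X * A) + trace (Y * C) + trace (S * B) := by
  rw [fromBlocks_multiply, trace_fromBlocks_eq, trace_add, trace_add, neg_mul_neg, ← transpose_mul,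
    trace_transpose, trace_mul_comm A]
  ring

/-- The nilpotent matrix defining the base form. -/
def baseMatrix (lev : K → ℕ) (t : ℕ) : Matrix (K ⊕ K) (K ⊕ K) ℂ :=
  fromBlocks 0 0 (levelProj lev t) 0

theorem baseMatrix_add (X Y S : Matrix K K ℂ) :
    baseMatrix lev t + fromBlocks X Y S (-Xᵀ) = fromBlocks X Y (levelProj lev t + S) (-Xᵀ) := by
  simp [baseMatrix, fromBlocks_add]

theorem IsGradedParabolic.eq_zero_of_commute (hq : IsGradedParabolic lev t q)
    {z : Matrix (K ⊕ K) (K ⊕ K) ℂ} (hz : z ∈ q) (h : ∀ y ∈ q, z * y = y * z) : z = 0 := by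
  obtain ⟨A, B, C, rfl, hB, hC, hA, hC'⟩ := hq.exists_blocks hz
  -- Distinct positive integers: nonzero differences `d k - d l` kill the off-diagonal entries of
  -- `A`, and nonzero sums `d k + d l` kill `B` and `C`. The diagonal of `A` is then killed by
  -- elementary matrices in the upper right corner.
  let d : K → ℂ := fun k => ((Fintype.equivFin K k : ℕ) + 1 : ℂ)
  have hd : ∀ k l, d k = d l → k = l := by
    intro k l hkl
    apply (Fintype.equivFin K).injective
    apply Fin.ext
    simpa [d] using hkl
  have hd' : ∀ k l, d k + d l ≠ 0 := by
    intro k l hkl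
    have : ((((Fintype.equivFin K k : ℕ) + 1 + ((Fintype.equivFin K l : ℕ) + 1) : ℕ)) : ℂ) = 0 := by
      push_cast; exact hkl
    rw [Nat.cast_eq_zero] at this
    omega
  have h1 := h (fromBlocks (diagonal d) 0 0 (-(diagonal d)ᵀ)) (hq.mem_iff_blocks.2
    ⟨rfl, by simp, by simp, blockTriangular_diagonal d, by simp⟩)
  simp only [fromBlocks_multiply, fromBlocks_inj, diagonal_transpose, mul_zero, zero_mul, add_zero,
    zero_add] at h1
  obtain ⟨h11, h12, h21, -⟩ := h1
  have eB : B = 0 := by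
    ext k l
    have := congrFun (congrFun h12 k) l
    rw [mul_neg, Matrix.neg_apply, mul_diagonal, diagonal_mul] at this
    have h2 : (d k + d l) * B k l = 0 := by linear_combination -this
    simpa [hd' k l] using h2
  have eC : C = 0 := by
    ext k l
    have := congrFun (congrFun h21 k) l
    rw [neg_mul, Matrix.neg_apply, mul_diagonal, diagonal_mul] at this
    have h2 : (d k + d l) * C k l = 0 := by linear_combination this
    simpa [hd' k l] using h2
  have eA : A = 0 := by
    ext k l
    have h2 := h (fromBlocks 0 (single l l 1) 0 (-(0 : Matrix K K ℂ)ᵀ)) (hq.mem_iff_blocks.2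
      ⟨rfl, by simp, by simp, fun _ _ _ => rfl, by simp⟩)
    simp only [fromBlocks_multiply, fromBlocks_inj, mul_zero, zero_mul, add_zero,
      zero_add, transpose_zero, neg_zero] at h2
    have h3 := congrFun (congrFun h2.2.1 k) l
    rcases eq_or_ne k l with rfl | hkl
    · simp at h3
      have h4 : A k k + A k k = 0 := by linear_combination h3
      simpa using h4
    · have := congrFun (congrFun h11 k) l
      simp only [mul_diagonal, diagonal_mul] at this
      have h5 : (d k - d l) * A k l = 0 := by linear_combination -this
      exact (mul_eq_zero.1 h5).resolve_left fun h0 => hkl (hd k l (sub_eq_zero.1 h0))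
  simp [eA, eB, eC]

/-- The form `x ↦ ∑ x(e_k, f_k)`, the sum being over all `k` of level less than `t`. -/
def baseForm (lev : K → ℕ) (t : ℕ) (q : LieSubalgebra ℂ (Matrix (K ⊕ K) (K ⊕ K) ℂ)) :
    Module.Dual ℂ q := tracePairing q (baseMatrix lev t)

/-! ### The Lie algebra stabiliser of the base form -/

theorem LevelSkew.mem (hq : IsGradedParabolic lev t q) {A B C : Matrix K K ℂ}
    (h : LevelSkew lev t A B C) : fromBlocks A B C (-Aᵀ) ∈ q :=
  hq.mem_iff_blocks.2 ⟨rfl, h.symmB, h.symmC, fun k l hkl => h.diag k l hkl.ne', h.zeroC⟩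

theorem LevelSkew.commute_baseMatrix {A B C : Matrix K K ℂ} (h : LevelSkew lev t A B C) :
    baseMatrix lev t * fromBlocks A B C (-Aᵀ) = fromBlocks A B C (-Aᵀ) * baseMatrix lev t := by
  simp only [baseMatrix, fromBlocks_multiply, zero_mul, mul_zero, add_zero, zero_add]
  congr 1
  · ext k l
    rw [mul_levelProj_apply, Matrix.zero_apply]
    split_ifs with hl
    · rw [← h.symmB, transpose_apply, h.zeroB _ _ hl]
    · rfl
  · ext k l
    rw [levelProj_mul_apply, mul_levelProj_apply, Matrix.neg_apply, transpose_apply]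
    rcases eq_or_ne (lev k) (lev l) with hkl | hkl
    · rw [hkl]
      split_ifs with hl
      · rw [h.skew l k hl]
      · rfl
    · rw [h.diag k l hkl, h.diag l k hkl.symm]; simp
  · ext k l
    rw [levelProj_mul_apply, Matrix.zero_apply]
    split_ifs with hk
    · exact h.zeroB k l hk
    · rfl

theorem conjTranspose_transpose_eq (A : Matrix K K ℂ) : Aᴴᵀ = Aᵀᴴ := by
  ext; simp

/-- The stabiliser of the base form is closed under conjugate transposition, which exchanges `B` and
`C`. This provides the positive definite trace argument used for perturbed forms. -/
theorem LevelSkew.conjTranspose {A B C : Matrix K K ℂ} (h : LevelSkew lev t A B C) :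
    LevelSkew lev t Aᴴ Cᴴ Bᴴ where
  diag k l hkl := by rw [conjTranspose_apply, h.diag l k hkl.symm, star_zero]
  skew k l hk := by
    rw [conjTranspose_apply, conjTranspose_apply, ← star_neg, h.skew k l hk, neg_neg]
  symmB := by rw [conjTranspose_transpose_eq, h.symmC]
  symmC := by rw [conjTranspose_transpose_eq, h.symmB]
  zeroB k l hk := by
    rw [conjTranspose_apply, ← h.symmC, transpose_apply, h.zeroC k l hk, star_zero]
  zeroC k l hk := by
    rw [conjTranspose_apply, ← h.symmB, transpose_apply, h.zeroB k l hk, star_zero]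

/-- Membership says that the commutator of the form's matrix with `x` is orthogonal to `q`. Its
lower left block `R` controls `A`, and its diagonal block `P` controls `B`. Allowing a perturbation
from the stabiliser itself treats the base form and its perturbations at once. -/
theorem IsGradedParabolic.levelSkew_of_mem_lieStabiliser (hq : IsGradedParabolic lev t q)
    {X Y S A B C : Matrix K K ℂ} (h : LevelSkew lev t X Y S)
    (hx : fromBlocks A B C (-Aᵀ) ∈ q)
    (hst : (⟨_, hx⟩ : q) ∈ lieStabiliser q
      (tracePairing q (baseMatrix lev t + fromBlocks X Y S (-Xᵀ)))) :
    LevelSkew lev t A B C := by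
  obtain ⟨-, hB, hC, hA, hC'⟩ := hq.mem_iff_blocks.1 hx
  have hle := hq.le
  set π := levelProj lev t with hπ
  have hC'' : ∀ k l, lev l < t → C k l = 0 := fun k l hl => by
    rw [← hC]; exact hC' l k hl
  have hS'' : ∀ k l, lev l < t → S k l = 0 := fun k l hl => by
    rw [← h.symmC]; exact h.zeroC l k hl
  set P := X * A + Y * C - A * X - B * (π + S) with hP
  set R := (π + S) * A - Xᵀ * C - C * X + Aᵀ * (π + S) with hR
  have hRT : Rᵀ = R := by
    simp only [hR, transpose_add, transpose_sub, transpose_mul, transpose_transpose, h.symmC, hC,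
      hπ, levelProj_transpose]
    abel
  obtain ⟨Q, hQ⟩ : ∃ Q, fromBlocks X Y (π + S) (-Xᵀ) * fromBlocks A B C (-Aᵀ) -
      fromBlocks A B C (-Aᵀ) * fromBlocks X Y (π + S) (-Xᵀ) = fromBlocks P Q R (-Pᵀ) := by
    refine ⟨X * B + Y * (-Aᵀ) - (A * Y + B * (-Xᵀ)), ?_⟩
    rw [fromBlocks_multiply, fromBlocks_multiply, sub_eq_add_neg, fromBlocks_neg, fromBlocks_add,
      fromBlocks_inj]
    refine ⟨?_, ?_, ?_, ?_⟩
    · rw [hP]; abel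
    · abel
    · rw [hR]; simp only [neg_mul]; abel
    · simp only [hP, transpose_sub, transpose_add, transpose_mul, h.symmB, h.symmC, hB, hC, hπ,
        levelProj_transpose, neg_mul, mul_neg, neg_neg]
      abel
  -- Testing against elements with zero lower left block already gives everything: all of `R`
  -- vanishes, and so do the entries of `P` on and below the block diagonal.
  have key : ∀ A' B' : Matrix K K ℂ, B'ᵀ = B' → A'.BlockTriangular lev →
      2 * trace (P * A') + trace (R * B') = 0 := by
    intro A' B' hB' hA'
    have hy : fromBlocks A' B' 0 (-A'ᵀ) ∈ q :=
      hq.mem_iff_blocks.2 ⟨rfl, hB', by simp, hA', by simp⟩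
    have h1 := mem_lieStabiliser.1 hst ⟨_, hy⟩
    rw [tracePairing_lie, baseMatrix_add, hQ, trace_fromBlocks_mul] at h1
    simpa using h1
  have hR0 : ∀ k l, R k l = 0 := by
    intro k l
    have h1 := key 0 (single k l 1 + single l k 1) (by simp [add_comm]) (fun _ _ _ => rfl)
    rw [mul_add, trace_add, trace_mul_single, trace_mul_single] at h1
    have h2 : R l k = R k l := by conv_lhs => rw [← hRT, transpose_apply]
    simp [h2] at h1
    exact h1
  have hP0 : ∀ k l, lev k ≤ lev l → P l k = 0 := by
    intro k l hkl
    have h1 := key (single k l 1) 0 (by simp) (blockTriangular_single hkl 1)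
    rw [trace_mul_single] at h1
    simpa using h1
  -- On rows below level `t` the equation `R = 0` reduces to `πA + Aᵀπ = 0`, as the products with
  -- `S`, `X` and `C` vanish there. Together with block triangularity this makes `A` block diagonal,
  -- and skew below level `t`.
  have eA : ∀ k l, lev k < t → A k l + (if lev l < t then A l k else 0) = 0 := by
    intro k l hk
    have h1 := hR0 k l
    rw [hR, add_mul, mul_add, Matrix.add_apply, Matrix.sub_apply, Matrix.sub_apply, Matrix.add_apply, Matrix.add_apply,
      levelProj_mul_apply, mul_levelProj_apply, if_pos hk, transpose_apply] at h1
    have z1 : (S * A) k l = 0 := by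
      rw [mul_apply]; exact Finset.sum_eq_zero fun m _ => by rw [h.zeroC k m hk, zero_mul]
    have z2 : (C * X) k l = 0 := by
      rw [mul_apply]; exact Finset.sum_eq_zero fun m _ => by rw [hC' k m hk, zero_mul]
    have z3 : (Xᵀ * C) k l = 0 := by
      rw [mul_apply]
      refine Finset.sum_eq_zero fun m _ => ?_
      rcases lt_or_ge (lev m) t with hm | hm
      · rw [hC' m l hm, mul_zero]
      · rw [transpose_apply, h.diag m k (by omega), zero_mul]
    have z4 : (Aᵀ * S) k l = 0 := by
      rw [mul_apply]
      refine Finset.sum_eq_zero fun m _ => ?_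
      rcases lt_or_ge (lev m) t with hm | hm
      · rw [h.zeroC m l hm, mul_zero]
      · rw [transpose_apply, hA (show lev k < lev m by omega), zero_mul]
    rw [z1, z2, z3, z4] at h1
    simpa using h1
  have hdiag : ∀ k l, lev k ≠ lev l → A k l = 0 := by
    intro k l hkl
    rcases lt_or_gt_of_ne hkl with hlt | hlt
    · have h1 := eA k l (lt_of_lt_of_le hlt (hle l))
      rw [hA hlt] at h1
      simpa using h1
    · exact hA hlt
  have hskew : ∀ k l, lev k < t → A l k = -A k l := by
    intro k l hk
    rcases eq_or_ne (lev k) (lev l) with hkl | hkl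
    · have h1 := eA k l hk
      rw [if_pos (hkl ▸ hk)] at h1
      linear_combination h1
    · rw [hdiag k l hkl, hdiag l k hkl.symm, neg_zero]
  have hXA : ∀ k l, lev k < t → (X * A) l k = (A * X) k l := by
    intro k l hk
    rw [mul_apply, mul_apply]
    refine Finset.sum_congr rfl fun m _ => ?_
    rcases eq_or_ne (lev k) (lev m) with hm | hm
    · rw [hskew k m hk, h.skew m l (hm ▸ hk)]; ring
    · rw [hdiag k m hm, hdiag m k hm.symm]; ring
  have hAX : ∀ k l, lev k < t → (A * X) l k = (X * A) k l := by
    intro k l hk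
    rw [mul_apply, mul_apply]
    refine Finset.sum_congr rfl fun m _ => ?_
    rcases eq_or_ne (lev k) (lev m) with hm | hm
    · rw [h.skew k m hk, hskew m l (hm ▸ hk)]; ring
    · rw [h.diag k m hm, h.diag m k hm.symm]; ring
  have eB : ∀ k l, lev k < t → lev k ≤ lev l → B l k = (X * A) l k - (A * X) l k := by
    intro k l hk hkl
    have h1 := hP0 k l hkl
    rw [hP, mul_add, Matrix.sub_apply, Matrix.sub_apply, Matrix.add_apply, Matrix.add_apply, mul_levelProj_apply,
      if_pos hk] at h1
    have z1 : (Y * C) l k = 0 := by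
      rw [mul_apply]; exact Finset.sum_eq_zero fun m _ => by rw [hC'' m k hk, mul_zero]
    have z2 : (B * S) l k = 0 := by
      rw [mul_apply]; exact Finset.sum_eq_zero fun m _ => by rw [hS'' m k hk, mul_zero]
    rw [z1, z2] at h1
    linear_combination -h1
  have hBs : ∀ k l, B k l = B l k := fun k l => by conv_lhs => rw [← hB, transpose_apply]
  -- Below level `t`, `B` equals the commutator `[X, A]` on and below the block diagonal. Within a
  -- level this commutator of skew matrices is skew, whereas `B` is symmetric; between different
  -- levels it is zero.
  have hB0 : ∀ k l, lev k < t → lev k ≤ lev l → B l k = 0 := by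
    intro k l hk hkl
    rcases eq_or_lt_of_le hkl with hkl' | hkl'
    · have h1 := eB k l hk hkl
      have h2 := eB l k (hkl' ▸ hk) hkl'.ge
      rw [hBs, hXA l k (hkl' ▸ hk), hAX l k (hkl' ▸ hk)] at h2
      have h3 : B l k + B l k = 0 := by linear_combination h1 + h2
      simpa using h3
    · rw [eB k l hk hkl, mul_apply, mul_apply, ← Finset.sum_sub_distrib]
      refine Finset.sum_eq_zero fun m _ => ?_
      rcases eq_or_ne (lev m) (lev l) with hm | hm
      · rw [h.diag m k (by omega), hdiag m k (by omega)]; ring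
      · rw [h.diag l m hm.symm, hdiag l m hm.symm]; ring
  refine ⟨hdiag, hskew, hB, hC, fun k l hk => ?_, hC'⟩
  rcases le_total (lev k) (lev l) with hkl | hkl
  · rw [hBs]; exact hB0 k l hk hkl
  · exact hB0 l k (by omega) hkl

theorem IsGradedParabolic.mem_lieStabiliser_baseForm (hq : IsGradedParabolic lev t q)
    {A B C : Matrix K K ℂ} (hx : fromBlocks A B C (-Aᵀ) ∈ q) :
    (⟨_, hx⟩ : q) ∈ lieStabiliser q (baseForm lev t q) ↔ LevelSkew lev t A B C := by
  constructor
  · intro h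
    refine hq.levelSkew_of_mem_lieStabiliser (X := 0) (Y := 0) (S := 0)
      ⟨by simp, by simp, by simp, by simp, by simp, by simp⟩ hx ?_
    simpa [baseForm] using h
  · intro h
    rw [mem_lieStabiliser]
    intro y
    rw [baseForm, tracePairing_lie, h.commute_baseMatrix, sub_self, zero_mul, trace_zero]

theorem IsGradedParabolic.exists_levelSkew (hq : IsGradedParabolic lev t q) {x : q}
    (hx : x ∈ lieStabiliser q (baseForm lev t q)) :
    ∃ A B C, LevelSkew lev t A B C ∧ x.1 = fromBlocks A B C (-Aᵀ) := by
  obtain ⟨x, hxq⟩ := x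
  obtain ⟨A, B, C, rfl, -⟩ := hq.exists_blocks hxq
  exact ⟨A, B, C, (hq.mem_lieStabiliser_baseForm hxq).1 hx, rfl⟩

theorem IsGradedParabolic.baseForm_eq_zero (hq : IsGradedParabolic lev t q) {x : q}
    (hx : x ∈ lieStabiliser q (baseForm lev t q)) : baseForm lev t q x = 0 := by
  obtain ⟨A, B, C, h, hx'⟩ := hq.exists_levelSkew hx
  rw [baseForm, tracePairing_apply, hx', baseMatrix, fromBlocks_multiply, trace_fromBlocks_eq]
  simp only [zero_mul, add_zero, trace_zero, zero_add]
  refine Finset.sum_eq_zero fun k _ => ?_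
  rw [diag_apply, levelProj_mul_apply]
  split_ifs with hk
  · exact h.zeroB k k hk
  · rfl

theorem IsGradedParabolic.isOfNilpotentType_baseForm (hq : IsGradedParabolic lev t q) :
    IsOfNilpotentType q (baseForm lev t q) := fun _ hx => hq.baseForm_eq_zero hx

end Graded

section Graded

variable {K : Type*} [Fintype K] [DecidableEq K]
variable {lev : K → ℕ} {t : ℕ} {q : LieSubalgebra ℂ (Matrix (K ⊕ K) (K ⊕ K) ℂ)}

/-! ### Forms that agree with the base form off the Levi factor -/

theorem IsGradedParabolic.pow_odd_mem (hq : IsGradedParabolic lev t q)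
    {x : Matrix (K ⊕ K) (K ⊕ K) ℂ} (hx : x ∈ q) (i : ℕ) : x ^ (2 * i + 1) ∈ q :=
  (hq.mem_iff _).2 ⟨pow_odd_mem_sp ((hq.mem_iff _).1 hx).1 i, ((hq.mem_iff _).1 hx).2.pow _⟩

theorem IsGradedParabolic.trace_eq_zero (hq : IsGradedParabolic lev t q)
    {x : Matrix (K ⊕ K) (K ⊕ K) ℂ} (hx : x ∈ q) : trace x = 0 := by
  obtain ⟨A, B, C, rfl, -⟩ := hq.exists_blocks hx
  rw [trace_fromBlocks_eq, trace_neg, trace_transpose, add_neg_cancel]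

-- For `x` in the stabiliser of the perturbed form, `w = [η, x]` lies in the stabiliser of the base
-- form, and so does `wᴴ`. Comparing both forms on the bracket of `x` with `wᴴ` gives `tr(w wᴴ) =
-- 0`, hence `w = 0`.
open scoped ComplexOrder in
theorem IsGradedParabolic.mem_lieStabiliser_add (hq : IsGradedParabolic lev t q)
    {X Y S : Matrix K K ℂ} (h : LevelSkew lev t X Y S) {x : q} :
    x ∈ lieStabiliser q (tracePairing q (baseMatrix lev t + fromBlocks X Y S (-Xᵀ))) ↔
      x ∈ lieStabiliser q (baseForm lev t q) ∧
        fromBlocks X Y S (-Xᵀ) * x.1 = x.1 * fromBlocks X Y S (-Xᵀ) := by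
  constructor
  · intro hx
    have hx0 : x ∈ lieStabiliser q (baseForm lev t q) := by
      obtain ⟨x, hxq⟩ := x
      obtain ⟨A, B, C, rfl, -⟩ := hq.exists_blocks hxq
      exact (hq.mem_lieStabiliser_baseForm hxq).2 (hq.levelSkew_of_mem_lieStabiliser h hxq hx)
    refine ⟨hx0, ?_⟩
    let η : q := ⟨_, h.mem hq⟩
    have hη : η ∈ lieStabiliser q (baseForm lev t q) := (hq.mem_lieStabiliser_baseForm _).2 h
    obtain ⟨A, B, C, hs, hw⟩ := hq.exists_levelSkew
      ((lieStabiliser q (baseForm lev t q)).lie_mem hη hx0)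
    have hs' := hs.conjTranspose
    have hwH : (fromBlocks A B C (-Aᵀ))ᴴ = fromBlocks Aᴴ Cᴴ Bᴴ (-(Aᴴ)ᵀ) := by
      rw [fromBlocks_conjTranspose, conjTranspose_neg, conjTranspose_transpose_eq]
    have h1 := mem_lieStabiliser.1 hx ⟨_, hs'.mem hq⟩
    have h0 := mem_lieStabiliser.1 hx0 ⟨_, hs'.mem hq⟩
    rw [baseForm, tracePairing_lie] at h0
    rw [tracePairing_lie, add_mul, mul_add, add_sub_add_comm, add_mul, trace_add, h0, zero_add]
      at h1
    change fromBlocks X Y S (-Xᵀ) * x.1 - x.1 * fromBlocks X Y S (-Xᵀ) =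
      fromBlocks A B C (-Aᵀ) at hw
    rw [hw] at h1
    have h2 : trace (fromBlocks A B C (-Aᵀ) * (fromBlocks A B C (-Aᵀ))ᴴ) = 0 := by
      rw [hwH]; exact h1
    rwa [trace_mul_conjTranspose_self_eq_zero_iff, ← hw, sub_eq_zero] at h2
  · rintro ⟨hx, hc⟩
    rw [mem_lieStabiliser]
    intro y
    have h0 := mem_lieStabiliser.1 hx y
    rw [baseForm, tracePairing_lie] at h0
    rw [tracePairing_lie, add_mul, mul_add, add_sub_add_comm, add_mul, trace_add, h0, hc, sub_self,
      zero_mul, trace_zero, add_zero]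

theorem IsGradedParabolic.mem_lieStabiliser_baseForm_iff_commute (hq : IsGradedParabolic lev t q)
    {x : q} : x ∈ lieStabiliser q (baseForm lev t q) ↔
      baseMatrix lev t * x.1 = x.1 * baseMatrix lev t := by
  constructor
  · intro hx
    obtain ⟨A, B, C, h, hx'⟩ := hq.exists_levelSkew hx
    rw [hx']; exact h.commute_baseMatrix
  · intro hx
    rw [mem_lieStabiliser]
    intro y
    rw [baseForm, tracePairing_lie, hx, sub_self, zero_mul, trace_zero]

theorem isNilpotent_matrix_of_trace_pow {N : Type*} [Fintype N] [DecidableEq N]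
    (x : Matrix N N ℂ) (h : ∀ k : ℕ, 1 ≤ k → trace (x ^ k) = 0) : IsNilpotent x := by
  have h1 : IsNilpotent (toLinAlgEquiv' x) := isNilpotent_of_trace_pow_eq_zero _ fun k hk => by
    rw [← map_pow]
    exact (trace_toLin'_eq _).trans (h k hk)
  exact (IsNilpotent.map_iff (toLinAlgEquiv' (R := ℂ) (n := N)).injective).1 h1

/-- Odd powers of `η` have trace zero because they lie in `sp`. They also lie in both stabilisers,
where both forms vanish, so `tr(η · η^(2i+1)) = 0` as well. Therefore `η` is nilpotent, and
reductive type leaves no nonzero nilpotent element in the centre of `q_γ`. -/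
theorem IsGradedParabolic.eq_zero_of_types (hq : IsGradedParabolic lev t q)
    {X Y S : Matrix K K ℂ} (h : LevelSkew lev t X Y S)
    (hr : IsOfReductiveType q
      (tracePairing q (baseMatrix lev t + fromBlocks X Y S (-Xᵀ))))
    (hn : IsOfNilpotentType q
      (tracePairing q (baseMatrix lev t + fromBlocks X Y S (-Xᵀ)))) :
    fromBlocks X Y S (-Xᵀ) = 0 := by
  set γ := tracePairing q (baseMatrix lev t + fromBlocks X Y S (-Xᵀ)) with hγ
  set η := fromBlocks X Y S (-Xᵀ) with hη
  have hηq : η ∈ q := h.mem hq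
  have hst : ∀ i : ℕ, (⟨η ^ (2 * i + 1), hq.pow_odd_mem hηq i⟩ : q) ∈ lieStabiliser q γ ∧
      (⟨η ^ (2 * i + 1), hq.pow_odd_mem hηq i⟩ : q) ∈ lieStabiliser q (baseForm lev t q) := by
    intro i
    have h1 : (⟨η ^ (2 * i + 1), hq.pow_odd_mem hηq i⟩ : q) ∈
        lieStabiliser q (baseForm lev t q) := by
      rw [hq.mem_lieStabiliser_baseForm_iff_commute]
      exact (show Commute (baseMatrix lev t) η from h.commute_baseMatrix).pow_right _
    exact ⟨(hq.mem_lieStabiliser_add h).2 ⟨h1, ((Commute.refl η).pow_right _)⟩, h1⟩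
  have htr : ∀ k : ℕ, 1 ≤ k → trace (η ^ k) = 0 := by
    intro k hk
    rcases Nat.even_or_odd' k with ⟨i, rfl | rfl⟩
    · obtain ⟨i, rfl⟩ := Nat.exists_eq_add_of_le' (show 1 ≤ i by omega)
      obtain ⟨h1, h2⟩ := hst i
      have h3 := hn _ h1
      have h4 := hq.baseForm_eq_zero h2
      rw [baseForm, tracePairing_apply] at h4
      rw [hγ, tracePairing_apply, add_mul, trace_add, h4, zero_add] at h3
      rw [show 2 * (i + 1) = (2 * i + 1) + 1 by ring, pow_succ']
      exact h3
    · exact hq.trace_eq_zero (hq.pow_odd_mem hηq i)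
  have hnil : IsNilpotent η := isNilpotent_matrix_of_trace_pow η htr
  -- The nilpotent elements of the centre of `q_γ`. Commutativity makes them a subspace, and
  -- conjugation by `Q_γ` preserves each defining condition.
  let c : Submodule ℂ q :=
    { carrier := {x | x ∈ lieStabiliser q γ ∧ IsNilpotent x.1 ∧
        ∀ y ∈ lieStabiliser q γ, Commute x.1 y.1}
      zero_mem' := ⟨zero_mem _, IsNilpotent.zero, fun y _ => Commute.zero_left _⟩
      add_mem' := fun ha hb => ⟨add_mem ha.1 hb.1,
        (ha.2.2 _ hb.1).isNilpotent_add ha.2.1 hb.2.1,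
        fun y hy => (ha.2.2 y hy).add_left (hb.2.2 y hy)⟩
      smul_mem' := fun s x hx => ⟨LieSubalgebra.smul_mem _ s hx.1, hx.2.1.smul s,
        fun y hy => (hx.2.2 y hy).smul_left s⟩ }
  have key := hr.commute_of_nilpotent c (fun x hx => hx.1) (fun x hx y hy => hx.2.2 y hy.1)
    (fun x hx => hx.2.1) (by
      intro g hg x hx
      refine ⟨Ad_mem_lieStabiliser hg hx.1, ?_, fun y hy => ?_⟩
      · obtain ⟨n, hn⟩ := hx.2.1
        refine ⟨n, ?_⟩
        rw [Ad_apply_val, Units.conj_pow, hn, mul_zero, zero_mul]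
      · have hy' := Ad_mem_lieStabiliser (inv_mem hg) hy
        have h1 := hx.2.2 _ hy'
        have h2 : Ad q g ⁅x, Ad q g⁻¹ y⁆ = 0 := by
          have : ⁅x, Ad q g⁻¹ y⁆ = 0 := Subtype.ext (sub_eq_zero.2 h1.eq)
          rw [this, map_zero]
        rw [Ad_lie, Ad_Ad_inv] at h2
        exact sub_eq_zero.1 (congrArg Subtype.val h2))
  refine hq.eq_zero_of_commute hηq (key ⟨η, hηq⟩ ⟨?_, hnil, fun y hy => ?_⟩)
  · simpa using (hst 0).1
  · exact ((hq.mem_lieStabiliser_add h).1 hy).2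

/-- The part of `ζ` that is self-adjoint for the symplectic form is trace-orthogonal to `sp`, so `ζ`
may be replaced by its skew part, `X = (P - Tᵀ)/2` with symmetrised corners. -/
theorem exists_trace_fromBlocks (ζ : Matrix (K ⊕ K) (K ⊕ K) ℂ) : ∃ X Y S : Matrix K K ℂ,
    Yᵀ = Y ∧ Sᵀ = S ∧ ∀ A B C : Matrix K K ℂ, Bᵀ = B → Cᵀ = C →
      trace (ζ * fromBlocks A B C (-Aᵀ)) =
        trace (fromBlocks X Y S (-Xᵀ) * fromBlocks A B C (-Aᵀ)) := by
  obtain ⟨P, Q, R, T, rfl⟩ : ∃ A B C D, ζ = fromBlocks A B C D :=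
    ⟨_, _, _, _, (fromBlocks_toBlocks ζ).symm⟩
  refine ⟨(1 / 2 : ℂ) • (P - Tᵀ), (1 / 2 : ℂ) • (Q + Qᵀ), (1 / 2 : ℂ) • (R + Rᵀ), ?_, ?_, ?_⟩
  · simp [add_comm]
  · simp [add_comm]
  · intro A B C hB hC
    have h1 : trace (Qᵀ * C) = trace (Q * C) := by
      rw [← trace_transpose, transpose_mul, transpose_transpose, hC, trace_mul_comm]
    have h2 : trace (Rᵀ * B) = trace (R * B) := by
      rw [← trace_transpose, transpose_mul, transpose_transpose, hB, trace_mul_comm]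
    have h3 : trace (T * Aᵀ) = trace (Tᵀ * A) := by
      rw [← trace_transpose, transpose_mul, transpose_transpose, trace_mul_comm]
    rw [trace_fromBlocks_mul, fromBlocks_multiply, trace_fromBlocks_eq]
    simp only [smul_mul_assoc, trace_smul, add_mul, sub_mul, trace_add, trace_sub, h1, h2, h3,
      mul_neg, trace_neg, smul_eq_mul]
    ring

end Graded

/-! ### Block Cholesky decomposition of complex symmetric matrices -/

section Cholesky

variable {K : Type*} [Fintype K] [DecidableEq K]

theorem transpose_eq_of_mem_adjoin {M X : Matrix K K ℂ} (hM : Mᵀ = M)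
    (hX : X ∈ Algebra.adjoin ℂ {M}) : Xᵀ = X := by
  rw [Algebra.adjoin_singleton_eq_range_aeval] at hX
  obtain ⟨p, rfl⟩ := hX
  change (Polynomial.aeval M p)ᵀ = Polynomial.aeval M p
  simp [Polynomial.aeval_eq_sum_range, transpose_sum, transpose_pow, hM]

theorem one_apply_swap (k l : K) : (1 : Matrix K K ℂ) k l = (1 : Matrix K K ℂ) l k := by
  simp [one_apply, eq_comm]

/-- The matrices that are scalar outside of the diagonal block of level `j`. -/
def levelBlockSubalgebra (lev : K → ℕ) (j : ℕ) : Subalgebra ℂ (Matrix K K ℂ) where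
  carrier := {M | ∃ c : ℂ, ∀ k l, (lev k ≠ j ∨ lev l ≠ j) → M k l = c * (1 : Matrix K K ℂ) k l}
  mul_mem' := by
    rintro M M' ⟨c, hc⟩ ⟨c', hc'⟩
    refine ⟨c * c', fun k l hkl => ?_⟩
    rw [mul_apply]
    by_cases hk : lev k = j
    · have hl := hkl.resolve_left (not_not.2 hk)
      rw [Finset.sum_eq_single l, hc k l hkl, hc' l l (Or.inl hl), one_apply_eq]
      · ring
      · intro m _ hm
        rw [hc' m l (Or.inr hl), one_apply_ne hm]; ring
      · simp
    · rw [Finset.sum_eq_single k, hc k k (Or.inl hk), hc' k l hkl, one_apply_eq]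
      · ring
      · intro m _ hm
        rw [hc k m (Or.inl hk), one_apply_ne hm.symm]; ring
      · simp
  add_mem' := by
    rintro M M' ⟨c, hc⟩ ⟨c', hc'⟩
    exact ⟨c + c', fun k l hkl => by rw [Matrix.add_apply, hc k l hkl, hc' k l hkl]; ring⟩
  algebraMap_mem' c := ⟨c, fun k l _ => by
    rw [Algebra.algebraMap_eq_smul_one, Matrix.smul_apply, smul_eq_mul]⟩

/-- A nondegenerate symmetric diagonal block can be normalised to the identity. -/
theorem exists_normalise_block {lev : K → ℕ} {j : ℕ} {S : Matrix K K ℂ} (hS : Sᵀ = S)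
    (hrow : ∀ k l, lev k < j → S k l = (1 : Matrix K K ℂ) k l)
    (hN : ∀ v : K → ℂ, (∀ k, j < lev k → v k = 0) → (∀ k, lev k ≤ j → (S *ᵥ v) k = 0) → v = 0) :
    ∃ G : Matrix K K ℂ, G.BlockTriangular lev ∧ IsUnit G ∧
      ∀ k l, (lev k < j ∨ lev k = j ∧ lev l = j) →
        (Gᵀ * S * G) k l = (1 : Matrix K K ℂ) k l := by
  -- The diagonal block of `S` at level `j`, completed by the identity. A kernel vector is supported
  -- on level `j` and lies in the radical excluded by `hN`, so `T` is invertible.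
  let T : Matrix K K ℂ := Matrix.of fun k l =>
    if lev k = j ∧ lev l = j then S k l else (1 : Matrix K K ℂ) k l
  have hT : ∀ k l, lev k = j → lev l = j → T k l = S k l := fun k l hk hl => by simp [T, hk, hl]
  have hT' : ∀ k l, (lev k ≠ j ∨ lev l ≠ j) → T k l = (1 : Matrix K K ℂ) k l := by
    intro k l hkl
    simp only [T, of_apply]
    rw [if_neg (by tauto)]
  have hTT : Tᵀ = T := by
    ext k l
    rw [transpose_apply]
    by_cases h : lev k = j ∧ lev l = j
    · rw [hT _ _ h.2 h.1, hT _ _ h.1 h.2, ← transpose_apply S, hS]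
    · rw [hT' l k (by tauto), hT' k l (by tauto), one_apply_swap]
  have hunit : IsUnit T := by
    rw [← Matrix.mulVec_injective_iff_isUnit]
    rw [← Matrix.coe_mulVecLin, ← LinearMap.ker_eq_bot, LinearMap.ker_eq_bot']
    intro v hv
    rw [mulVecLin_apply] at hv
    have h1 : ∀ k, lev k ≠ j → v k = 0 := by
      intro k hk
      have := congrFun hv k
      rw [mulVec, dotProduct, Finset.sum_eq_single k, hT' k k (Or.inl hk), one_apply_eq,
        one_mul] at this
      · exact this
      · intro m _ hm
        rw [hT' k m (Or.inl hk), one_apply_ne hm.symm, zero_mul]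
      · simp
    refine hN v (fun k hk => h1 k hk.ne') fun k hk => ?_
    rcases hk.lt_or_eq with hk | hk
    · rw [mulVec, dotProduct]
      refine Finset.sum_eq_zero fun m _ => ?_
      rcases eq_or_ne k m with rfl | hm
      · rw [h1 k hk.ne, mul_zero]
      · rw [hrow k m hk, one_apply_ne hm, zero_mul]
    · rw [← Pi.zero_apply (M := fun _ => ℂ) k, ← hv, mulVec, mulVec, dotProduct, dotProduct]
      refine Finset.sum_congr rfl fun m _ => ?_
      by_cases hm : lev m = j
      · rw [hT k m hk hm]
      · rw [h1 m hm, mul_zero, mul_zero]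
  obtain ⟨X, hX, hXT⟩ := exists_matrix_log hunit
  -- An inverse square root of `T`. As a polynomial in `T` it is symmetric and is scalar off the
  -- block of level `j`.
  set G := NormedSpace.exp ((-(1 / 2) : ℂ) • X) with hG
  have hGmem : G ∈ Algebra.adjoin ℂ {T} := exp_mem_subalgebra (Subalgebra.smul_mem _ hX _)
  have hGT : Gᵀ = G := transpose_eq_of_mem_adjoin hTT hGmem
  have hGTG : G * T * G = 1 := by
    have hc : ∀ a b : ℂ, Commute (a • X) (b • X) := fun a b =>
      ((Commute.refl X).smul_left a).smul_right b
    have h1 : T = NormedSpace.exp ((1 : ℂ) • X) := by rw [one_smul, hXT]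
    rw [h1, hG, ← Matrix.exp_add_of_commute _ _ (hc _ _), ← add_smul,
      ← Matrix.exp_add_of_commute _ _ (hc _ _), ← add_smul]
    norm_num
  obtain ⟨c, hc⟩ : G ∈ levelBlockSubalgebra lev j := by
    have : Algebra.adjoin ℂ {T} ≤ levelBlockSubalgebra lev j := by
      rw [Algebra.adjoin_le_iff, Set.singleton_subset_iff]
      exact ⟨1, fun k l hkl => by rw [hT' k l hkl, one_mul]⟩
    exact this hGmem
  -- The logarithm is not unique, so the scalar `c` may be `-1`; only its square enters the
  -- congruence on rows below level `j`.
  have hcc : ∀ k, lev k ≠ j → c * c = 1 := by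
    intro k hk
    have h1 := congrFun (congrFun hGTG k) k
    rw [mul_assoc, mul_apply, Finset.sum_eq_single k, mul_apply, Finset.sum_eq_single k,
      hc k k (Or.inl hk), hT' k k (Or.inl hk), one_apply_eq] at h1
    · linear_combination h1
    · intro m _ hm
      rw [hT' k m (Or.inl hk), one_apply_ne hm.symm, zero_mul]
    · simp
    · intro m _ hm
      rw [hc k m (Or.inl hk), one_apply_ne hm.symm]; ring
    · simp
  refine ⟨G, ?_, Matrix.isUnit_exp _, ?_⟩
  · intro k l hkl
    have hne : k ≠ l := by rintro rfl; exact lt_irrefl _ hkl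
    rw [hc k l (by omega), one_apply_ne hne, mul_zero]
  · rintro k l (hk | ⟨hk, hl⟩)
    · rw [hGT, mul_assoc, mul_apply, Finset.sum_eq_single k, mul_apply, Finset.sum_eq_single k,
        hc k k (Or.inl hk.ne), hrow k k hk, hc k l (Or.inl hk.ne), one_apply_eq]
      · linear_combination (1 : Matrix K K ℂ) k l * hcc k hk.ne
      · intro m _ hm
        rw [hrow k m hk, one_apply_ne hm.symm, zero_mul]
      · simp
      · intro m _ hm
        rw [hc k m (Or.inl hk.ne), one_apply_ne hm.symm]; ring
      · simp
    · rw [← hGTG, hGT, mul_apply, mul_apply]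
      refine Finset.sum_congr rfl fun m _ => ?_
      by_cases hm : lev m = j
      · congr 1
        rw [mul_apply, mul_apply]
        refine Finset.sum_congr rfl fun m' _ => ?_
        by_cases hm' : lev m' = j
        · rw [hT m' m hm' hm]
        · rw [hc k m' (Or.inr hm'), one_apply_ne (by rintro rfl; exact hm' hk)]; ring
      · rw [hc m l (Or.inl hm), one_apply_ne (by rintro rfl; exact hm hl)]; ring

/-- Elimination of the entries to the right of a diagonal block equal to the identity. -/
theorem exists_eliminate_row {lev : K → ℕ} {j : ℕ} {S : Matrix K K ℂ} (hS : Sᵀ = S)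
    (hrow : ∀ k l, (lev k < j ∨ lev k = j ∧ lev l = j) → S k l = (1 : Matrix K K ℂ) k l) :
    ∃ E : Matrix K K ℂ, E.BlockTriangular lev ∧ IsUnit E ∧
      ∀ k l, lev k ≤ j → (Eᵀ * S * E) k l = (1 : Matrix K K ℂ) k l := by
  -- The part of `S` to the right of the identity block. It has square zero, so `1 - Z` is
  -- invertible with inverse `1 + Z`; its transpose alters only rows of level above `j`.
  let Z : Matrix K K ℂ := Matrix.of fun k l => if lev k = j ∧ j < lev l then S k l else 0
  have hZ : ∀ k l, lev k = j → j < lev l → Z k l = S k l := fun k l hk hl => by simp [Z, hk, hl]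
  have hZ' : ∀ k l, (lev k ≠ j ∨ lev l ≤ j) → Z k l = 0 := by
    intro k l hkl
    simp only [Z, of_apply]
    rw [if_neg (by omega)]
  have hZZ : Z * Z = 0 := by
    ext k l
    rw [mul_apply]
    refine Finset.sum_eq_zero fun m _ => ?_
    rcases le_or_gt (lev m) j with hm | hm
    · rw [hZ' k m (Or.inr hm), zero_mul]
    · rw [hZ' m l (Or.inl hm.ne'), mul_zero]
  have h1 : ∀ k l, lev k ≤ j → (S * (1 - Z)) k l = (1 : Matrix K K ℂ) k l := by
    intro k l hk
    rw [mul_sub, mul_one, Matrix.sub_apply]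
    have h2 : (S * Z) k l = Z k l := by
      rw [mul_apply, Finset.sum_eq_single k]
      · rcases hk.lt_or_eq with hk | hk
        · rw [hZ' k l (Or.inl hk.ne), mul_zero]
        · rw [hrow k k (Or.inr ⟨hk, hk⟩), one_apply_eq, one_mul]
      · intro m _ hm
        by_cases hm' : lev m = j
        · rw [hrow k m (by omega), one_apply_ne hm.symm, zero_mul]
        · rw [hZ' m l (Or.inl hm'), mul_zero]
      · simp
    rw [h2]
    rcases hk.lt_or_eq with hk | hk
    · rw [hZ' k l (Or.inl hk.ne), sub_zero, hrow k l (Or.inl hk)]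
    · rcases lt_trichotomy (lev l) j with hl | hl | hl
      · rw [hZ' k l (Or.inr hl.le), sub_zero, ← hS, transpose_apply, hrow l k (Or.inl hl),
          one_apply_swap]
      · rw [hZ' k l (Or.inr hl.le), sub_zero, hrow k l (Or.inr ⟨hk, hl⟩)]
      · rw [hZ k l hk hl, sub_self, one_apply_ne (by rintro rfl; omega)]
  refine ⟨1 - Z, ?_, ?_, ?_⟩
  · refine blockTriangular_one.sub fun k l hkl => hZ' k l (by omega)
  · have e1 : (1 - Z) * (1 + Z) = 1 := by
      have : (1 - Z) * (1 + Z) = 1 - Z * Z := by noncomm_ring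
      rw [this, hZZ, sub_zero]
    have e2 : (1 + Z) * (1 - Z) = 1 := by
      have : (1 + Z) * (1 - Z) = 1 - Z * Z := by noncomm_ring
      rw [this, hZZ, sub_zero]
    exact ⟨⟨1 - Z, 1 + Z, e1, e2⟩, rfl⟩
  · intro k l hk
    rw [mul_assoc, transpose_sub, transpose_one, sub_mul, one_mul, Matrix.sub_apply, h1 k l hk,
      mul_apply, Finset.sum_eq_zero, sub_zero]
    intro m _
    rw [transpose_apply, hZ' m k (Or.inr hk), zero_mul]

/-- If a complex symmetric matrix is nondegenerate on the coordinate subspaces of level at most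
`j`, for all `j < t`, then an upper block triangular change of basis makes it the identity on the
levels below `t`. -/
theorem exists_block_cholesky {lev : K → ℕ} {t : ℕ} {S : Matrix K K ℂ} (hS : Sᵀ = S)
    (hN : ∀ j < t, ∀ v : K → ℂ, (∀ k, j < lev k → v k = 0) →
      (∀ k, lev k ≤ j → (S *ᵥ v) k = 0) → v = 0) :
    ∃ A : Matrix K K ℂ, A.BlockTriangular lev ∧ IsUnit A ∧
      ∀ k l, lev k < t → (Aᵀ * S * A) k l = (1 : Matrix K K ℂ) k l := by
  suffices h : ∀ j ≤ t, ∃ A : Matrix K K ℂ, A.BlockTriangular lev ∧ IsUnit A ∧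
      ∀ k l, lev k < j → (Aᵀ * S * A) k l = (1 : Matrix K K ℂ) k l from h t le_rfl
  intro j
  induction j with
  | zero => exact fun _ => ⟨1, blockTriangular_one, isUnit_one, fun k l hk => absurd hk (by omega)⟩
  | succ j ih =>
    intro hj
    obtain ⟨A, hA, hAu, hrow⟩ := ih (by omega)
    have hS' : (Aᵀ * S * A)ᵀ = Aᵀ * S * A := by
      rw [transpose_mul, transpose_mul, hS, transpose_transpose, mul_assoc]
    have hdet : IsUnit A.det := (isUnit_iff_isUnit_det A).1 hAu
    have hinv : A⁻¹.BlockTriangular lev := by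
      let _ := hAu.invertible
      exact blockTriangular_inv_of_blockTriangular hA
    -- The nondegeneracy hypothesis passes to `AᵀSA` because `A` and its inverse preserve the span
    -- of the coordinates of level at most `j`.
    obtain ⟨G, hG, hGu, hrowG⟩ := exists_normalise_block hS' hrow (by
      intro v hv h0
      have hAv : A *ᵥ v = 0 := by
        refine hN j (by omega) _ (fun k hk => ?_) fun k hk => ?_
        · rw [mulVec, dotProduct]
          refine Finset.sum_eq_zero fun m _ => ?_
          rcases le_or_gt (lev m) j with hm | hm
          · rw [hA (show lev m < lev k by omega), zero_mul]
          · rw [hv m hm, mul_zero]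
        · have e : S *ᵥ (A *ᵥ v) = (A⁻¹)ᵀ *ᵥ ((Aᵀ * S * A) *ᵥ v) := by
            rw [mulVec_mulVec, mulVec_mulVec, mul_assoc Aᵀ, ← mul_assoc (A⁻¹)ᵀ, ← transpose_mul,
              mul_nonsing_inv _ hdet, transpose_one, one_mul]
          rw [e, mulVec, dotProduct]
          refine Finset.sum_eq_zero fun m _ => ?_
          rcases le_or_gt (lev m) j with hm | hm
          · rw [h0 m hm, mul_zero]
          · rw [transpose_apply, hinv (show lev k < lev m by omega), zero_mul]
      have : A⁻¹ *ᵥ (A *ᵥ v) = 0 := by rw [hAv, mulVec_zero]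
      rwa [mulVec_mulVec, nonsing_inv_mul _ hdet, one_mulVec] at this)
    have hS'' : (Gᵀ * (Aᵀ * S * A) * G)ᵀ = Gᵀ * (Aᵀ * S * A) * G := by
      rw [transpose_mul, transpose_mul, hS', transpose_transpose, mul_assoc Gᵀ]
    obtain ⟨E, hE, hEu, hrowE⟩ := exists_eliminate_row hS'' hrowG
    refine ⟨A * G * E, (hA.mul hG).mul hE, (hAu.mul hGu).mul hEu, fun k l hk => ?_⟩
    rw [← hrowE k l (by omega)]
    simp only [transpose_mul, mul_assoc]

end Cholesky

section Graded

variable {K : Type*} [Fintype K] [DecidableEq K]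
variable {lev : K → ℕ} {t : ℕ} {q : LieSubalgebra ℂ (Matrix (K ⊕ K) (K ⊕ K) ℂ)}

/-! ### Normal form of the linear forms of reductive type -/

theorem IsGradedParabolic.blockTriangular (hq : IsGradedParabolic lev t q)
    (g : connectedGroup q) :
    (g.1 : Matrix (K ⊕ K) (K ⊕ K) ℂ).BlockTriangular (grade lev t) := by
  obtain ⟨g, hg⟩ := g
  have hexp : ∀ x ∈ q, (NormedSpace.exp x).BlockTriangular (grade lev t) := fun x hx =>
    (mem_blockTriangularSubalgebra (R := ℂ)).1 (exp_mem_subalgebra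
      ((mem_blockTriangularSubalgebra (R := ℂ)).2 ((hq.mem_iff x).1 hx).2))
  induction hg using Subgroup.closure_induction'' with
  | mem g hg =>
    obtain ⟨x, hx, h⟩ := hg
    simpa only [h] using hexp x hx
  | inv_mem g hg =>
    obtain ⟨x, hx, h⟩ := hg
    have : ((g⁻¹ : GL (K ⊕ K) ℂ) : Matrix (K ⊕ K) (K ⊕ K) ℂ) = NormedSpace.exp (-x) := by
      rw [Matrix.exp_neg, ← h, Matrix.coe_units_inv]
    simpa only [this] using hexp _ (q.neg_mem hx)
  | one => simpa using blockTriangular_one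
  | mul g h _ _ ihg ihh => simpa using ihg.mul ihh

theorem IsGradedParabolic.exists_eq_tracePairing (hq : IsGradedParabolic lev t q)
    (γ : Module.Dual ℂ q) : ∃ X Y S : Matrix K K ℂ, Yᵀ = Y ∧ Sᵀ = S ∧
      γ = tracePairing q (fromBlocks X Y S (-Xᵀ)) := by
  obtain ⟨ζ, rfl⟩ := MaxRed.exists_eq_tracePairing γ
  obtain ⟨X, Y, S, hY, hS, h⟩ := exists_trace_fromBlocks ζ
  refine ⟨X, Y, S, hY, hS, ?_⟩
  ext x
  obtain ⟨x, hx⟩ := x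
  obtain ⟨A, B, C, rfl, hB, hC, -⟩ := hq.exists_blocks hx
  exact h A B C hB hC

/-- A vector `v` in the radical of `S` on the levels up to `j` makes the matrix with corner `v vᵀ`
stabilise the form: pairing with `A` gives `(Av)·(Sv) = 0`, since `Av` stays in these levels, and `v
vᵀ C = 0`, since `C` lives on level `t`. Reductive type then makes this matrix central, hence zero.
-/
theorem IsGradedParabolic.nondegenerate_of_isOfReductiveType (hq : IsGradedParabolic lev t q)
    {X Y S : Matrix K K ℂ} (hS : Sᵀ = S)
    (hr : IsOfReductiveType q (tracePairing q (fromBlocks X Y S (-Xᵀ)))) {j : ℕ} (hj : j < t)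
    {v : K → ℂ} (hv : ∀ k, j < lev k → v k = 0) (h0 : ∀ k, lev k ≤ j → (S *ᵥ v) k = 0) :
    v = 0 := by
  set γ := tracePairing q (fromBlocks X Y S (-Xᵀ)) with hγ
  -- Only entries from degrees above `t` to degrees below `t` survive. Any two such matrices have
  -- product zero, and block triangular conjugation preserves the condition, which gives the
  -- required `Q_γ`-stable space.
  let T : Set (Matrix (K ⊕ K) (K ⊕ K) ℂ) :=
    {x | ∀ i j, (t ≤ grade lev t i ∨ grade lev t j ≤ t) → x i j = 0}
  have hT0 : ∀ x ∈ T, ∀ y ∈ T, x * y = 0 := by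
    intro x hx y hy
    ext i k
    rw [mul_apply]
    refine Finset.sum_eq_zero fun u _ => ?_
    rcases le_total t (grade lev t u) with hu | hu
    · rw [hy u k (Or.inl hu), mul_zero]
    · rw [hx i u (Or.inr hu), zero_mul]
  let c : Submodule ℂ q :=
    { carrier := {x | x ∈ lieStabiliser q γ ∧ x.1 ∈ T}
      zero_mem' := ⟨zero_mem _, fun _ _ _ => rfl⟩
      add_mem' := fun {a b} ha hb => ⟨add_mem ha.1 hb.1, fun i k hik => by
        change a.1 i k + b.1 i k = 0
        rw [ha.2 i k hik, hb.2 i k hik, add_zero]⟩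
      smul_mem' := fun s x hx => ⟨LieSubalgebra.smul_mem _ s hx.1, fun i k hik => by
        change s * x.1 i k = 0
        rw [hx.2 i k hik, mul_zero]⟩ }
  have key := hr.commute_of_nilpotent c (fun x hx => hx.1)
    (fun x hx y hy => (hT0 _ hx.2 _ hy.2).trans (hT0 _ hy.2 _ hx.2).symm)
    (fun x hx => ⟨2, by rw [sq]; exact hT0 _ hx.2 _ hx.2⟩) (by
      intro g hg x hx
      refine ⟨Ad_mem_lieStabiliser hg hx.1, fun i k hik => ?_⟩
      have hg1 := hq.blockTriangular g
      have hg2 := hq.blockTriangular g⁻¹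
      rw [Ad_apply_val, mul_apply]
      refine Finset.sum_eq_zero fun w _ => ?_
      rw [mul_apply, Finset.sum_mul]
      refine Finset.sum_eq_zero fun u _ => ?_
      by_cases hu : grade lev t u < grade lev t i
      · rw [hg1 hu]; ring
      · by_cases hw : grade lev t k < grade lev t w
        · have : ((g.1⁻¹ : GL (K ⊕ K) ℂ) : Matrix (K ⊕ K) (K ⊕ K) ℂ) w k = 0 := hg2 hw
          rw [this]; ring
        · rw [hx.2 u w (by omega)]; ring)
  have hvv : fromBlocks 0 (vecMulVec v v) 0 (-(0 : Matrix K K ℂ)ᵀ) ∈ q :=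
    hq.mem_iff_blocks.2 ⟨rfl, transpose_vecMulVec v v, by simp, fun _ _ _ => rfl, by simp⟩
  have hle := hq.le
  have hmem : (⟨_, hvv⟩ : q) ∈ c := by
    constructor
    · rw [mem_lieStabiliser]
      rintro ⟨y, hy⟩
      obtain ⟨A, B, C, rfl, hB, hC, hA, hC'⟩ := hq.exists_blocks hy
      have e1 : vecMulVec v v * C = 0 := by
        ext k l
        rw [mul_apply]
        refine Finset.sum_eq_zero fun m _ => ?_
        rw [vecMulVec_apply]
        rcases le_or_gt (lev m) j with hm | hm
        · rw [hC' m l (by omega), mul_zero]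
        · rw [hv m hm]; ring
      have e2 : trace (vecMulVec v v * S * A) = 0 := by
        rw [trace_mul_comm, vecMulVec_mul, mul_vecMulVec, trace_vecMulVec, dotProduct]
        refine Finset.sum_eq_zero fun k _ => ?_
        rcases le_or_gt (lev k) j with hk | hk
        · rw [← mulVec_transpose, hS, h0 k hk, mul_zero]
        · have : (A *ᵥ v) k = 0 := by
            rw [mulVec, dotProduct]
            refine Finset.sum_eq_zero fun m _ => ?_
            rcases le_or_gt (lev m) j with hm | hm
            · rw [hA (show lev m < lev k by omega), zero_mul]
            · rw [hv m hm, mul_zero]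
          rw [this, zero_mul]
      have e3 : trace (S * vecMulVec v v * Aᵀ) = 0 := by
        rw [← trace_transpose, transpose_mul, transpose_mul, hS, transpose_vecMulVec,
          transpose_transpose, trace_mul_comm]
        exact e2
      have e4 : trace (X * vecMulVec v v * C) = 0 := by rw [mul_assoc, e1, mul_zero, trace_zero]
      have e5 : trace (vecMulVec v v * Xᵀ * C) = 0 := by
        rw [← trace_transpose, transpose_mul, transpose_mul, hC, transpose_vecMulVec,
          transpose_transpose, trace_mul_comm]
        exact e4
      rw [hγ, tracePairing_lie, fromBlocks_multiply, fromBlocks_multiply, sub_eq_add_neg,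
        fromBlocks_neg, fromBlocks_add, fromBlocks_multiply, trace_fromBlocks_eq]
      simp only [mul_zero, zero_mul, add_zero, zero_add, transpose_zero, neg_zero, mul_neg,
        neg_mul, add_mul, trace_add, trace_neg, neg_neg, e2, e3, e4, e5]
    · rintro (k | k) (l | l) hkl
      · rfl
      · simp only [grade, Sum.elim_inl, Sum.elim_inr] at hkl
        simp only [fromBlocks_apply₁₂, vecMulVec_apply]
        have hk := hle k
        have hl := hle l
        rcases hkl with h | h
        · rw [hv k (by omega), zero_mul]
        · rw [hv l (by omega), mul_zero]
      · rfl
      · simp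
  have hz := hq.eq_zero_of_commute hvv (key _ hmem)
  ext k
  have h1 := congrFun (congrFun hz (Sum.inl k)) (Sum.inr k)
  simpa [vecMulVec_apply] using h1

theorem exp_fromBlocks_diagonal (a d : Matrix K K ℂ) :
    NormedSpace.exp (fromBlocks a 0 0 d) =
      fromBlocks (NormedSpace.exp a) 0 0 (NormedSpace.exp d) := by
  refine (hasSum_matrix_exp _).unique ?_
  have ha := hasSum_matrix_exp a
  have hd := hasSum_matrix_exp d
  simp only [fromBlocks_diagonal_pow, fromBlocks_smul, smul_zero]
  refine Pi.hasSum.2 fun i => Pi.hasSum.2 fun j => ?_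
  rcases i with i | i <;> rcases j with j | j
  · exact Pi.hasSum.1 (Pi.hasSum.1 ha i) j
  · exact hasSum_zero
  · exact hasSum_zero
  · exact Pi.hasSum.1 (Pi.hasSum.1 hd i) j

theorem exp_of_mul_self_eq_zero {N : Type*} [Fintype N] [DecidableEq N] {x : Matrix N N ℂ}
    (hx : x * x = 0) : NormedSpace.exp x = 1 + x := by
  refine (hasSum_matrix_exp x).unique ?_
  have h := hasSum_sum_of_ne_finset_zero (f := fun n : ℕ => ((n.factorial : ℂ)⁻¹) • x ^ n)
    (s := Finset.range 2) (L := SummationFilter.unconditional ℕ) (fun n hn => by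
      rw [pow_eq_zero_of_le (m := 2) (not_lt.1 (Finset.mem_range.not.1 hn)) (by rw [sq, hx]), smul_zero])
  simpa [Finset.sum_range_succ] using h

/-- The group is generated by exponentials, so `A` needs a logarithm inside the parabolic. A
logarithm that is a polynomial in `A` is again block triangular. The sign is chosen so that
conjugation replaces `S` by `AᵀSA`. -/
theorem IsGradedParabolic.exists_levi_element (hq : IsGradedParabolic lev t q)
    {A : Matrix K K ℂ} (hA : A.BlockTriangular lev) (hu : IsUnit A) :
    ∃ g : connectedGroup q,
      (g.1 : Matrix (K ⊕ K) (K ⊕ K) ℂ) = fromBlocks A⁻¹ 0 0 Aᵀ ∧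
      ((g.1⁻¹ : GL (K ⊕ K) ℂ) : Matrix (K ⊕ K) (K ⊕ K) ℂ) = fromBlocks A 0 0 (A⁻¹)ᵀ := by
  obtain ⟨a, ha, rfl⟩ := exists_matrix_log hu
  have haB : a.BlockTriangular lev := by
    have : Algebra.adjoin ℂ {NormedSpace.exp a} ≤ blockTriangularSubalgebra ℂ ℂ lev := by
      rw [Algebra.adjoin_le_iff, Set.singleton_subset_iff]
      exact hA
    exact this ha
  have hx : fromBlocks (-a) 0 0 (-(-a)ᵀ) ∈ q :=
    hq.mem_iff_blocks.2 ⟨rfl, by simp, by simp, haB.neg, by simp⟩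
  refine ⟨expGroup q hx, ?_, ?_⟩
  · rw [expGroup_val, exp_fromBlocks_diagonal, Matrix.exp_neg, transpose_neg, neg_neg,
      Matrix.exp_transpose]
  · rw [expGroup_inv_val, fromBlocks_neg, neg_zero, exp_fromBlocks_diagonal, neg_neg, neg_neg,
      Matrix.exp_transpose, Matrix.exp_neg]

theorem IsGradedParabolic.exists_unipotent_element (hq : IsGradedParabolic lev t q)
    {b : Matrix K K ℂ} (hb : bᵀ = b) :
    ∃ g : connectedGroup q,
      (g.1 : Matrix (K ⊕ K) (K ⊕ K) ℂ) = fromBlocks 1 b 0 1 ∧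
      ((g.1⁻¹ : GL (K ⊕ K) ℂ) : Matrix (K ⊕ K) (K ⊕ K) ℂ) = fromBlocks 1 (-b) 0 1 := by
  have hx : fromBlocks 0 b 0 (-(0 : Matrix K K ℂ)ᵀ) ∈ q :=
    hq.mem_iff_blocks.2 ⟨rfl, hb, by simp, fun _ _ _ => rfl, by simp⟩
  refine ⟨expGroup q hx, ?_, ?_⟩
  · rw [expGroup_val, exp_of_mul_self_eq_zero, ← fromBlocks_one, fromBlocks_add]
    · simp
    · simp [fromBlocks_multiply]
  · rw [expGroup_inv_val, exp_of_mul_self_eq_zero, ← fromBlocks_one, fromBlocks_neg, fromBlocks_add]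
    · simp
    · simp [fromBlocks_multiply]

/-- If the restriction of the form to the upper right corner is the identity on the levels below
`t`, then it is conjugate to the sum of the base form and a form on the Levi factor. -/
theorem IsGradedParabolic.exists_levelSkew_form (hq : IsGradedParabolic lev t q)
    {X Y S : Matrix K K ℂ} (hY : Yᵀ = Y) (hS : Sᵀ = S)
    (hrow : ∀ k l, lev k < t → S k l = (1 : Matrix K K ℂ) k l) :
    ∃ (g : connectedGroup q) (X' Y' S' : Matrix K K ℂ), LevelSkew lev t X' Y' S' ∧
      (Ad q).dual g (tracePairing q (fromBlocks X Y S (-Xᵀ))) =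
        tracePairing q (baseMatrix lev t + fromBlocks X' Y' S' (-X'ᵀ)) := by
  have hle := hq.le
  -- Conjugation replaces `X` by `X + bS`, and `S` is the identity on columns below level `t`. The
  -- symmetric `b` is chosen to cancel `X` below the block diagonal and the symmetric part of its
  -- diagonal blocks below level `t`, leaving skew blocks there and level `t` free.
  let b : Matrix K K ℂ := Matrix.of fun k l =>
    if lev l < lev k then -X k l else if lev k < lev l then -X l k else
      if lev k < t then -(X k l + X l k) / 2 else 0
  have hb : bᵀ = b := by
    ext k l
    simp only [b, transpose_apply, of_apply]
    rcases lt_trichotomy (lev k) (lev l) with h | h | h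
    · simp [h, h.not_gt]
    · simp [h, add_comm]
    · simp [h, h.not_gt]
  obtain ⟨g, hg, hg'⟩ := hq.exists_unipotent_element hb
  set X1 := X + b * S with hX1
  set Y1 := Y - X1 * b - b * Xᵀ with hY1
  have hconj : (g.1 : Matrix (K ⊕ K) (K ⊕ K) ℂ) * fromBlocks X Y S (-Xᵀ) * (g.1⁻¹ : GL (K ⊕ K) ℂ) =
      fromBlocks X1 Y1 S (-X1ᵀ) := by
    rw [hg, hg', fromBlocks_multiply, fromBlocks_multiply, fromBlocks_inj]
    refine ⟨?_, ?_, ?_, ?_⟩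
    · simp [hX1]
    · simp [hY1, hX1]; noncomm_ring
    · simp
    · simp [hX1, transpose_add, transpose_mul, hS, hb]
  have hX1e : ∀ k l, lev l < t → X1 k l = X k l + b k l := by
    intro k l hl
    rw [hX1, Matrix.add_apply, mul_apply, Finset.sum_eq_single l]
    · rw [hrow l l hl, one_apply_eq, mul_one]
    · intro m _ hm
      rw [← hS, transpose_apply, hrow l m hl, one_apply_ne hm.symm, mul_zero]
    · simp
  have hX1z : ∀ k l, lev l < lev k → X1 k l = 0 := by
    intro k l hkl
    rw [hX1e k l (lt_of_lt_of_le hkl (hle k))]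
    simp [b, hkl]
  have hX1s : ∀ k l, lev k < t → lev k = lev l → X1 l k = -X1 k l := by
    intro k l hk hkl
    rw [hX1e k l (hkl ▸ hk), hX1e l k hk]
    have hl : lev l < t := hkl ▸ hk
    simp only [b, of_apply, hkl, lt_irrefl, if_false, hl, if_true]
    ring
  have hY1T : Y1ᵀ = Y1 := by
    simp only [hY1, hX1, transpose_sub, transpose_mul, transpose_add, hY, hb, hS,
      transpose_transpose]
    noncomm_ring
  -- Entries of `X1` above the block diagonal and of `Y1` outside level `t` pair only with entries
  -- that vanish on `q`; dropping them leaves the linear form unchanged.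
  let X' : Matrix K K ℂ := Matrix.of fun k l => if lev k = lev l then X1 k l else 0
  let Y' : Matrix K K ℂ := Matrix.of fun k l => if lev k < t ∨ lev l < t then 0 else Y1 k l
  refine ⟨g, X', Y', S - levelProj lev t, ⟨?_, ?_, ?_, ?_, ?_, ?_⟩, ?_⟩
  · intro k l hkl
    simp [X', hkl]
  · intro k l hk
    simp only [X', of_apply]
    by_cases hkl : lev k = lev l
    · rw [if_pos hkl, if_pos hkl.symm, hX1s k l hk hkl]
    · rw [if_neg hkl, if_neg (Ne.symm hkl), neg_zero]
  · ext k l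
    simp only [Y', transpose_apply, of_apply]
    rw [← transpose_apply Y1, hY1T]
    simp only [or_comm]
  · rw [transpose_sub, hS, levelProj_transpose]
  · intro k l hk
    simp [Y', hk]
  · intro k l hk
    rw [Matrix.sub_apply, hrow k l hk, levelProj, diagonal_apply, one_apply]
    split_ifs <;> simp
  · rw [dual_tracePairing, hconj, baseMatrix_add, add_sub_cancel]
    ext x
    obtain ⟨x, hx⟩ := x
    obtain ⟨A, B, C, rfl, hB, hC, hA, hC'⟩ := hq.exists_blocks hx
    rw [tracePairing_apply, tracePairing_apply, trace_fromBlocks_mul, trace_fromBlocks_mul]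
    have e1 : trace (X1 * A) = trace (X' * A) := by
      simp only [trace, diag_apply, mul_apply]
      refine Finset.sum_congr rfl fun k _ => Finset.sum_congr rfl fun l _ => ?_
      simp only [X', of_apply]
      rcases lt_trichotomy (lev k) (lev l) with h | h | h
      · rw [hA h]; ring
      · rw [if_pos h]
      · rw [hX1z k l h, if_neg h.ne']
    have e2 : trace (Y1 * C) = trace (Y' * C) := by
      simp only [trace, diag_apply, mul_apply]
      refine Finset.sum_congr rfl fun k _ => Finset.sum_congr rfl fun l _ => ?_
      simp only [Y', of_apply]
      split_ifs with h
      · rcases h with h | h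
        · rw [← hC, transpose_apply, hC' k l h]; ring
        · rw [hC' l k h]; ring
      · rfl
    rw [e1, e2]

/-- A linear form of reductive and nilpotent type is conjugate to the base form. -/
theorem IsGradedParabolic.exists_dual_eq_baseForm (hq : IsGradedParabolic lev t q)
    {γ : Module.Dual ℂ q} (hr : IsOfReductiveType q γ) (hn : IsOfNilpotentType q γ) :
    ∃ g : connectedGroup q, (Ad q).dual g γ = baseForm lev t q := by
  obtain ⟨X, Y, S, hY, hS, hγ⟩ := hq.exists_eq_tracePairing γ
  obtain ⟨A, hA, hAu, hrow⟩ := exists_block_cholesky (lev := lev) (t := t) hS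
    fun j hj v hv h0 => hq.nondegenerate_of_isOfReductiveType hS (hγ ▸ hr) hj hv h0
  have hdet : IsUnit A.det := (isUnit_iff_isUnit_det A).1 hAu
  obtain ⟨g₁, hg₁, hg₁'⟩ := hq.exists_levi_element hA hAu
  have h1 : (Ad q).dual g₁ γ = tracePairing q (fromBlocks (A⁻¹ * X * A) (A⁻¹ * Y * (A⁻¹)ᵀ)
      (Aᵀ * S * A) (-(A⁻¹ * X * A)ᵀ)) := by
    rw [hγ, dual_tracePairing, hg₁, hg₁', fromBlocks_multiply, fromBlocks_multiply]
    simp [transpose_mul, mul_assoc]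
  obtain ⟨g₂, X', Y', S', hsk, h2⟩ := hq.exists_levelSkew_form
    (X := A⁻¹ * X * A) (Y := A⁻¹ * Y * (A⁻¹)ᵀ) (S := Aᵀ * S * A)
    (by rw [transpose_mul, transpose_mul, hY, transpose_transpose, mul_assoc])
    (by rw [transpose_mul, transpose_mul, hS, transpose_transpose, mul_assoc]) hrow
  have h3 : (Ad q).dual (g₂ * g₁) γ =
      tracePairing q (baseMatrix lev t + fromBlocks X' Y' S' (-X'ᵀ)) := by
    rw [map_mul, Module.End.mul_apply, h1, h2]
  have h4 := hq.eq_zero_of_types hsk (h3 ▸ hr.dual _) (h3 ▸ hn.dual _)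
  exact ⟨g₂ * g₁, by rw [h3, h4, add_zero]; rfl⟩

end Graded

section Graded

variable {K : Type*} [Fintype K] [DecidableEq K]
variable {lev : K → ℕ} {t : ℕ} {q : LieSubalgebra ℂ (Matrix (K ⊕ K) (K ⊕ K) ℂ)}

/-! ### The base form is of reductive type -/

theorem exp_mem_symplecticGroup {x : Matrix (K ⊕ K) (K ⊕ K) ℂ}
    (hx : x ∈ LieAlgebra.Symplectic.sp K ℂ) :
    NormedSpace.exp x ∈ symplecticGroup K ℂ := by
  rw [SymplecticGroup.mem_iff']
  rw [mem_sp_iff_mul] at hx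
  have hJ : IsUnit (J K ℂ) := (isUnit_iff_isUnit_det _).2 (isUnit_det_J K ℂ)
  have h1 : xᵀ = J K ℂ * (-x) * (J K ℂ)⁻¹ := by
    rw [mul_neg, ← hx, mul_assoc, mul_nonsing_inv _ (isUnit_det_J K ℂ), mul_one]
  rw [← Matrix.exp_transpose, h1, Matrix.exp_conj _ _ hJ, mul_assoc, mul_assoc,
    Matrix.exp_neg, mul_assoc, ← mul_assoc (J K ℂ)⁻¹, nonsing_inv_mul _ (isUnit_det_J K ℂ), one_mul,
    nonsing_inv_mul _ ((isUnit_iff_isUnit_det _).1 (Matrix.isUnit_exp x)), mul_one]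

theorem IsGradedParabolic.mem_symplecticGroup (hq : IsGradedParabolic lev t q)
    (g : connectedGroup q) : (g.1 : Matrix (K ⊕ K) (K ⊕ K) ℂ) ∈ symplecticGroup K ℂ := by
  obtain ⟨g, hg⟩ := g
  induction hg using Subgroup.closure_induction'' with
  | mem g hg =>
    obtain ⟨x, hx, h⟩ := hg
    simpa only [h] using exp_mem_symplecticGroup ((hq.mem_iff x).1 hx).1
  | inv_mem g hg =>
    obtain ⟨x, hx, h⟩ := hg
    have : ((g⁻¹ : GL (K ⊕ K) ℂ) : Matrix (K ⊕ K) (K ⊕ K) ℂ) = NormedSpace.exp (-x) := by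
      rw [Matrix.exp_neg, ← h, Matrix.coe_units_inv]
    simpa only [this] using exp_mem_symplecticGroup ((hq.mem_iff _).1 (q.neg_mem hx)).1
  | one => exact one_mem _
  | mul g h _ _ ihg ihh => simpa using mul_mem ihg ihh

theorem IsGradedParabolic.inv_eq_fromBlocks (hq : IsGradedParabolic lev t q)
    {g : connectedGroup q} {A B C D : Matrix K K ℂ}
    (hg : (g.1 : Matrix (K ⊕ K) (K ⊕ K) ℂ) = fromBlocks A B C D) :
    ((g.1⁻¹ : GL (K ⊕ K) ℂ) : Matrix (K ⊕ K) (K ⊕ K) ℂ) = fromBlocks Dᵀ (-Bᵀ) (-Cᵀ) Aᵀ := by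
  rw [Matrix.coe_units_inv, SymplecticGroup.inv_eq_symplectic_inv _ (hq.mem_symplecticGroup g), hg]
  simp [Matrix.J, fromBlocks_transpose, fromBlocks_multiply, fromBlocks_neg]

theorem levelProj_mul_self (lev : K → ℕ) (t : ℕ) :
    levelProj lev t * levelProj lev t = levelProj lev t := by
  ext k l
  rw [levelProj_mul_apply]
  split_ifs with h
  · rfl
  · rw [levelProj, diagonal_apply, if_neg h, ite_self]

/-- The stabiliser of the base form consists of block diagonal matrices for the grading that
commute with the base matrix and its transpose. -/
theorem IsGradedParabolic.groupStabiliser_baseForm (hq : IsGradedParabolic lev t q)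
    {g : connectedGroup q} (hg : g ∈ groupStabiliser q (baseForm lev t q)) :
    (g.1 : Matrix (K ⊕ K) (K ⊕ K) ℂ) * baseMatrix lev t =
        baseMatrix lev t * (g.1 : Matrix (K ⊕ K) (K ⊕ K) ℂ) ∧
      (g.1 : Matrix (K ⊕ K) (K ⊕ K) ℂ) * (baseMatrix lev t)ᴴ =
        (baseMatrix lev t)ᴴ * (g.1 : Matrix (K ⊕ K) (K ⊕ K) ℂ) ∧
      ∀ i j, grade lev t i ≠ grade lev t j → (g.1 : Matrix (K ⊕ K) (K ⊕ K) ℂ) i j = 0 := by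
  have hle := hq.le
  obtain ⟨A, B, C, D, hABCD⟩ : ∃ A B C D,
      (g.1 : Matrix (K ⊕ K) (K ⊕ K) ℂ) = fromBlocks A B C D :=
    ⟨_, _, _, _, (fromBlocks_toBlocks _).symm⟩
  have hinv := hq.inv_eq_fromBlocks hABCD
  have hBT := hq.blockTriangular g
  rw [hABCD] at hBT
  have hA : A.BlockTriangular lev := fun k l hkl => hBT (i := Sum.inl k) (j := Sum.inl l) hkl
  have hC : ∀ k l, (lev k < t ∨ lev l < t) → C k l = 0 := fun k l hkl =>
    hBT (i := Sum.inr k) (j := Sum.inl l) (by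
      simp only [grade, Sum.elim_inl, Sum.elim_inr]; have := hle l; have := hle k; omega)
  have hD : ∀ k l, lev k < lev l → D k l = 0 := fun k l hkl =>
    hBT (i := Sum.inr k) (j := Sum.inr l) (by
      simp only [grade, Sum.elim_inr]; have := hle l; have := hle k; omega)
  set π := levelProj lev t with hπ
  have hππ : π * π = π := levelProj_mul_self lev t
  have hπT : πᵀ = π := levelProj_transpose lev t
  have hm1 := g.1.mul_inv
  have hm2 := g.1.inv_mul
  rw [hABCD, hinv, fromBlocks_multiply, ← fromBlocks_one, fromBlocks_inj] at hm1 hm2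
  obtain ⟨r1, r2, -, -⟩ := hm1
  obtain ⟨l1, -, -, -⟩ := hm2
  -- the two conditions for `g` to preserve the form
  have hstab : ∀ A' B' : Matrix K K ℂ, B'ᵀ = B' → A'.BlockTriangular lev →
      2 * trace (-(Bᵀ * π * A) * A') + trace (Aᵀ * π * A * B') = trace (π * B') := by
    intro A' B' hB' hA'
    have hx : fromBlocks A' B' 0 (-A'ᵀ) ∈ q :=
      hq.mem_iff_blocks.2 ⟨rfl, hB', by simp, hA', by simp⟩
    have h1 := mem_groupStabiliser.1 hg ⟨_, hx⟩
    rw [baseForm, tracePairing_apply, tracePairing_apply, Ad_apply_val, ← mul_assoc, ← mul_assoc,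
      trace_mul_comm, ← mul_assoc, ← mul_assoc, hABCD, hinv] at h1
    have h2 : fromBlocks Dᵀ (-Bᵀ) (-Cᵀ) Aᵀ * baseMatrix lev t * fromBlocks A B C D =
        fromBlocks (-(Bᵀ * π * A)) (-(Bᵀ * π * B)) (Aᵀ * π * A) (-(-(Bᵀ * π * A))ᵀ) := by
      rw [baseMatrix, fromBlocks_multiply, fromBlocks_multiply]
      simp [transpose_mul, hπT, mul_assoc, ← hπ]
    have h3 : baseMatrix lev t = fromBlocks 0 0 π (-(0 : Matrix K K ℂ)ᵀ) := by
      simp [baseMatrix, hπ]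
    rw [h2, trace_fromBlocks_mul, h3, trace_fromBlocks_mul] at h1
    simpa using h1
  have hAA : Aᵀ * π * A = π := by
    ext k l
    have h1 := hstab 0 (single k l 1 + single l k 1) (by simp [add_comm]) (fun _ _ _ => rfl)
    rw [mul_add, trace_add, trace_mul_single, trace_mul_single, mul_add, trace_add,
      trace_mul_single, trace_mul_single] at h1
    have e1 : (Aᵀ * π * A) l k = (Aᵀ * π * A) k l := by
      rw [← transpose_apply (Aᵀ * π * A)]
      simp only [transpose_mul, transpose_transpose, hπT, mul_assoc]
    have e2 : π l k = π k l := by rw [← transpose_apply π, hπT]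
    rw [e1, e2] at h1
    simp only [mul_zero, trace_zero, zero_add, MulOpposite.op_one, one_smul] at h1
    linear_combination h1 / 2
  have hE : ∀ k l, lev k ≤ lev l → (Bᵀ * π * A) l k = 0 := by
    intro k l hkl
    have h1 := hstab (single k l 1) 0 (by simp) (blockTriangular_single hkl 1)
    rw [trace_mul_single] at h1
    simpa using h1
  -- `A` commutes with the projection and is orthogonal below level `t`
  have a1 : π * A * π = A * π := by
    ext k l
    rw [mul_levelProj_apply, mul_levelProj_apply, levelProj_mul_apply]
    split_ifs with h1 h2
    · rfl
    · rw [hA (show lev l < lev k by omega)]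
    · rfl
  have a1T : π * Aᵀ * π = π * Aᵀ := by
    have := congrArg transpose a1
    simpa [transpose_mul, hπT, mul_assoc] using this
  -- `A` cut down to the levels below `t` and completed by the identity. It is orthogonal and block
  -- upper triangular, so its inverse `Mᵀ` is both upper and lower triangular, and `M` is block
  -- diagonal.
  set M := A * π + (1 - π) with hM
  have hMM : Mᵀ * M = 1 := by
    have e : Mᵀ * M = π * (Aᵀ * π * A) * π + (1 - π) := by
      have hMT : Mᵀ = π * Aᵀ + (1 - π) := by
        simp [hM, transpose_mul, hπT]
      have e1 : (π * Aᵀ) * (1 - π) = 0 := by rw [mul_sub, mul_one, a1T, sub_self]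
      have e2 : (1 - π) * (A * π) = 0 := by
        rw [sub_mul, one_mul, ← mul_assoc, a1, sub_self]
      have e3 : (1 - π) * (1 - π) = 1 - π := by
        rw [mul_sub, sub_mul, sub_mul, hππ]; simp
      rw [hMT, hM, add_mul, mul_add, mul_add, e1, e2, e3, add_zero, zero_add]
      congr 1
      rw [← a1T]
      simp only [mul_assoc]
    rw [e, hAA, hππ, hππ]
    abel
  have hMM' : M * Mᵀ = 1 := mul_eq_one_comm.1 hMM
  have hMdiag : ∀ k l, lev k ≠ lev l → M k l = 0 := by
    have hMB : M.BlockTriangular lev :=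
      (hA.mul (blockTriangular_diagonal _)).add (blockTriangular_one.sub (blockTriangular_diagonal _))
    have hMi : M⁻¹ = Mᵀ := inv_eq_right_inv hMM'
    have hMTB : Mᵀ.BlockTriangular lev := by
      let _ : Invertible M := ⟨Mᵀ, hMM, hMM'⟩
      rw [← hMi]
      exact blockTriangular_inv_of_blockTriangular hMB
    intro k l hkl
    rcases lt_or_gt_of_ne hkl with h | h
    · exact hMTB h
    · exact hMB h
  have a2 : A * π * Aᵀ = π := by
    have e : A * π * Aᵀ = π * (M * Mᵀ) * π := by
      have e1 : π * M = A * π := by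
        rw [hM, mul_add, mul_sub, mul_one, hππ, sub_self, add_zero, ← mul_assoc, a1]
      have e2 : Mᵀ * π = π * Aᵀ := by
        have := congrArg transpose e1
        simpa [transpose_mul, hπT] using this
      rw [mul_assoc π, mul_assoc M, e2, ← mul_assoc, e1, mul_assoc A π (π * Aᵀ), ← mul_assoc π π,
        hππ, mul_assoc]
    rw [e, hMM', mul_one, hππ]
  have a3 : π * A = A * π := by
    calc π * A = A * (π * Aᵀ) * A := by rw [← mul_assoc A, a2]
      _ = A * π * (Aᵀ * π * A) := by rw [← a1T]; simp only [mul_assoc]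
      _ = A * π := by rw [hAA, mul_assoc, hππ]
  have hAdiag : ∀ k l, lev k ≠ lev l → A k l = 0 := by
    intro k l hkl
    rcases lt_or_gt_of_ne hkl with h | h
    · have h1 := hMdiag k l hkl
      have h2 : π k l = 0 := diagonal_apply_ne _ fun e => hkl (congrArg lev e)
      have hk : lev k < t := lt_of_lt_of_le h (hle l)
      rw [hM, Matrix.add_apply, ← a3, levelProj_mul_apply, if_pos hk, Matrix.sub_apply, h2,
        one_apply_ne fun e => hkl (congrArg lev e)] at h1
      simpa using h1
    · exact hA h
  -- the upper right block vanishes outside of level `t`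
  set E := Bᵀ * π * A with hEdef
  have b0 : A * Bᵀ = B * Aᵀ := by
    have : -(A * Bᵀ) + B * Aᵀ = 0 := by rw [← r2, mul_neg]
    exact (neg_add_eq_zero.1 this)
  have b1 : A * E = B * π := by
    calc A * E = (A * Bᵀ) * π * A := by rw [hEdef]; simp only [mul_assoc]
      _ = B * (Aᵀ * π * A) := by rw [b0]; simp only [mul_assoc]
      _ = B * π := by rw [hAA]
  -- The stabiliser condition kills `E` only on and below the block diagonal. The symplectic
  -- relation `ABᵀ = BAᵀ` makes `πE` symmetric, which kills the remaining entries.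
  have b2 : (π * E)ᵀ = π * E := by
    calc (π * E)ᵀ = Aᵀ * π * (B * π) := by
          rw [hEdef]; simp only [transpose_mul, transpose_transpose, hπT, mul_assoc]
      _ = (Aᵀ * π * A) * E := by rw [← b1]; simp only [mul_assoc]
      _ = π * E := by rw [hAA]
  have b3 : E = 0 := by
    ext l k
    rcases le_or_gt (lev k) (lev l) with h | h
    · exact hE k l h
    · have hl : lev l < t := lt_of_lt_of_le h (hle k)
      have h1 : (π * E) l k = (π * E) k l := by rw [← transpose_apply (π * E), b2]
      rw [levelProj_mul_apply, levelProj_mul_apply, if_pos hl, hE l k h.le, ite_self] at h1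
      exact h1
  have b4 : B * π = 0 := by rw [← b1, b3, mul_zero]
  have b5 : π * B = 0 := by
    have h1 : Bᵀ * π = 0 := by
      calc Bᵀ * π = Bᵀ * (π * (A * π * Aᵀ)) := by rw [a2, hππ]
        _ = E * (π * Aᵀ) := by rw [hEdef]; simp only [mul_assoc]
        _ = 0 := by rw [b3, zero_mul]
    have := congrArg transpose h1
    simpa [transpose_mul, hπT] using this
  have c1 : C * π = 0 := by
    ext k l
    rw [mul_levelProj_apply]
    split_ifs with h
    · exact hC k l (Or.inr h)
    · rfl
  have c2 : π * C = 0 := by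
    ext k l
    rw [levelProj_mul_apply]
    split_ifs with h
    · exact hC k l (Or.inl h)
    · rfl
  have d1 : π * D = A * π := by
    have h1 : Dᵀ * π = π * Aᵀ := by
      calc Dᵀ * π = Dᵀ * (A * π * Aᵀ) := by rw [a2]
        _ = (Dᵀ * A + -Bᵀ * C) * π * Aᵀ := by
            rw [add_mul, mul_assoc (-Bᵀ), c1, mul_zero, add_zero]; simp only [mul_assoc]
        _ = π * Aᵀ := by rw [l1, one_mul]
    have := congrArg transpose h1
    simpa [transpose_mul, hπT] using this
  have d2 : D * π = π * A := by
    have h1 : π * Dᵀ = Aᵀ * π := by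
      calc π * Dᵀ = Aᵀ * (π * (A * Dᵀ + B * -Cᵀ)) := by
            rw [mul_add, ← mul_assoc π B, b5, zero_mul, add_zero]
            conv_lhs => rw [← hAA]
            simp only [mul_assoc]
        _ = Aᵀ * π := by rw [r1, mul_one]
    have := congrArg transpose h1
    simpa [transpose_mul, hπT] using this
  have hπH : πᴴ = π := by
    rw [hπ, levelProj, diagonal_conjTranspose]
    congr 1
    ext k
    simp only [Pi.star_apply]
    split_ifs <;> simp
  rw [hABCD]
  refine ⟨?_, ?_, ?_⟩
  · rw [baseMatrix, fromBlocks_multiply, fromBlocks_multiply]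
    simp [← hπ, b4, b5, d2]
  · rw [baseMatrix, fromBlocks_conjTranspose, fromBlocks_multiply, fromBlocks_multiply]
    simp [← hπ, hπH, c1, c2, d1]
  · rintro (k | k) (l | l) hkl <;> simp only [grade, Sum.elim_inl, Sum.elim_inr] at hkl <;>
      have hk := hle k <;> have hl := hle l
    · exact hAdiag k l hkl
    · simp only [fromBlocks_apply₁₂]
      rcases lt_or_ge (lev k) t with h | h
      · have := congrFun (congrFun b5 k) l
        rwa [levelProj_mul_apply, if_pos h] at this
      · have := congrFun (congrFun b4 k) l
        rwa [mul_levelProj_apply, if_pos (by omega)] at this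
    · exact hC k l (by omega)
    · simp only [fromBlocks_apply₂₂]
      rcases lt_trichotomy (lev k) (lev l) with h | h | h
      · exact hD k l h
      · omega
      · have := congrFun (congrFun d2 k) l
        rw [mul_levelProj_apply, if_pos (by omega), levelProj_mul_apply,
          hAdiag k l (by omega), ite_self] at this
        exact this

/-- The block diagonal part of a matrix with respect to a grading. -/
def gradedPart {N : Type*} (gr : N → ℕ) (M : Matrix N N ℂ) : Matrix N N ℂ :=
  Matrix.of fun i j => if gr i = gr j then M i j else 0

/-- Within one diagonal block, block triangularity forces every intermediate index to have the same
degree. Thus projection to the block diagonal part is multiplicative on block triangular matrices.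
-/
theorem gradedPart_mul {N : Type*} [Fintype N] {gr : N → ℕ} {M M' : Matrix N N ℂ}
    (hM : M.BlockTriangular gr) (hM' : M'.BlockTriangular gr) :
    gradedPart gr (M * M') = gradedPart gr M * gradedPart gr M' := by
  ext i j
  simp only [gradedPart, of_apply, mul_apply]
  split_ifs with hij
  · refine Finset.sum_congr rfl fun k _ => ?_
    rcases lt_trichotomy (gr i) (gr k) with h | h | h
    · rw [hM' (hij ▸ h)]; simp [h.ne]
    · rw [if_pos h, if_pos (h ▸ hij)]
    · rw [hM h]; simp
  · refine (Finset.sum_eq_zero fun k _ => ?_).symm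
    by_cases h : gr i = gr k
    · rw [if_neg (fun h' => hij (h.trans h')), mul_zero]
    · rw [if_neg h, zero_mul]

theorem gradedPart_exp {N : Type*} [Fintype N] [DecidableEq N] {gr : N → ℕ} {x : Matrix N N ℂ}
    (hx : x.BlockTriangular gr) :
    gradedPart gr (NormedSpace.exp x) = NormedSpace.exp (gradedPart gr x) := by
  refine HasSum.unique ?_ (hasSum_matrix_exp (gradedPart gr x))
  have hpow : ∀ n, (gradedPart gr x) ^ n = gradedPart gr (x ^ n) := by
    intro n
    induction n with
    | zero =>
      ext i j
      simp only [gradedPart, of_apply, pow_zero, one_apply]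
      split_ifs with h1 h2 <;> simp_all
    | succ n ih => rw [pow_succ, pow_succ, ih, gradedPart_mul (hx.pow n) hx]
  refine Pi.hasSum.2 fun i => Pi.hasSum.2 fun j => ?_
  have h := Pi.hasSum.1 (Pi.hasSum.1 (hasSum_matrix_exp x) i) j
  simp only [hpow]
  simp only [gradedPart, of_apply, Matrix.smul_apply]
  split_ifs with hij
  · exact h
  · simp

/-- Conjugate transposition reverses block triangularity, but it preserves block diagonal matrices,
so it can be applied after projection to the Levi factor. -/
theorem IsGradedParabolic.gradedPart_conjTranspose_mem (hq : IsGradedParabolic lev t q)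
    {x : Matrix (K ⊕ K) (K ⊕ K) ℂ} (hx : x ∈ q) :
    (gradedPart (grade lev t) x)ᴴ ∈ q := by
  have hle := hq.le
  rw [hq.mem_iff]
  constructor
  · obtain ⟨A, B, C, rfl, hB, hC, -⟩ := hq.exists_blocks hx
    have h1 : gradedPart (grade lev t) (fromBlocks A B C (-Aᵀ)) = fromBlocks
        (Matrix.of fun k l => if lev k = lev l then A k l else 0)
        (Matrix.of fun k l => if lev k = 2 * t - lev l then B k l else 0)
        (Matrix.of fun k l => if 2 * t - lev k = lev l then C k l else 0)
        (Matrix.of fun k l => if lev k = lev l then -A l k else 0) := by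
      ext (k | k) (l | l)
      · rfl
      · rfl
      · rfl
      · have hk := hle k
        have hl := hle l
        simp only [gradedPart, grade, Sum.elim_inr, of_apply, fromBlocks_apply₂₂,
          Matrix.neg_apply, transpose_apply]
        congr 1
        exact propext ⟨fun _ => by omega, fun _ => by omega⟩
    rw [h1, fromBlocks_conjTranspose, mem_sp_iff]
    refine ⟨?_, ?_, ?_⟩
    · ext k l
      simp only [conjTranspose_apply, of_apply, Matrix.neg_apply, transpose_apply, eq_comm]
      split_ifs <;> simp
    · ext k l
      have hk := hle k
      have hl := hle l
      have hs : C k l = C l k := by conv_lhs => rw [← hC, transpose_apply]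
      simp only [conjTranspose_apply, of_apply, transpose_apply, hs]
      congr 2
      exact propext ⟨fun _ => by omega, fun _ => by omega⟩
    · ext k l
      have hk := hle k
      have hl := hle l
      have hs : B k l = B l k := by conv_lhs => rw [← hB, transpose_apply]
      simp only [conjTranspose_apply, of_apply, transpose_apply, hs]
      congr 2
      exact propext ⟨fun _ => by omega, fun _ => by omega⟩
  · intro i j hij
    simp [gradedPart, hij.ne]

/-- The map `g ↦ (gradedPart g)ᴴ` reverses products and sends exponential generators to exponentials
of elements of `q`. This gives closure under adjoints for stabiliser elements, even though the
stabiliser need not be connected and its elements need not come from its Lie algebra. -/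
theorem IsGradedParabolic.exists_gradedPart_conjTranspose (hq : IsGradedParabolic lev t q)
    (g : connectedGroup q) : ∃ g' : connectedGroup q,
      (g'.1 : Matrix (K ⊕ K) (K ⊕ K) ℂ) =
        (gradedPart (grade lev t) (g.1 : Matrix (K ⊕ K) (K ⊕ K) ℂ))ᴴ := by
  have hexp : ∀ (x : Matrix (K ⊕ K) (K ⊕ K) ℂ) (hx : x ∈ q),
      (expGroup q (hq.gradedPart_conjTranspose_mem hx)).1.1 =
      (gradedPart (grade lev t) (NormedSpace.exp x))ᴴ := by
    intro x hx
    rw [gradedPart_exp ((hq.mem_iff x).1 hx).2, ← Matrix.exp_conjTranspose]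
    rfl
  obtain ⟨g, hg⟩ := g
  induction hg using Subgroup.closure_induction'' with
  | mem g hg =>
    obtain ⟨x, hx, h⟩ := hg
    exact ⟨_, (hexp x hx).trans (by simp only [h])⟩
  | inv_mem g hg =>
    obtain ⟨x, hx, h⟩ := hg
    have : ((g⁻¹ : GL (K ⊕ K) ℂ) : Matrix (K ⊕ K) (K ⊕ K) ℂ) = NormedSpace.exp (-x) := by
      rw [Matrix.exp_neg, ← h, Matrix.coe_units_inv]
    exact ⟨_, (hexp (-x) (q.neg_mem hx)).trans (by simp only [this])⟩
  | one =>
    refine ⟨1, ?_⟩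
    ext i j
    simp only [gradedPart, OneMemClass.coe_one, Units.val_one, conjTranspose_apply, of_apply,
      one_apply]
    split_ifs with h1 h2 h3 <;> simp_all
  | mul g h hg hh ihg ihh =>
    obtain ⟨g', hg'⟩ := ihg
    obtain ⟨h', hh'⟩ := ihh
    refine ⟨h' * g', ?_⟩
    have e := gradedPart_mul (hq.blockTriangular ⟨g, hg⟩) (hq.blockTriangular ⟨h, hh⟩)
    simp only [Subgroup.coe_mul, Units.val_mul]
    rw [e, conjTranspose_mul, hg', hh']

open scoped ComplexOrder in
/-- The Hermitian form `tr (xᴴ y)` on a space of matrices. -/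
@[reducible]
def traceCore {N : Type*} [Fintype N] [DecidableEq N] (q : LieSubalgebra ℂ (Matrix N N ℂ)) :
    InnerProductSpace.Core ℂ q where
  inner x y := trace (x.1ᴴ * y.1)
  conj_inner_symm x y := by
    change star (trace (y.1ᴴ * x.1)) = _
    rw [← trace_conjTranspose, conjTranspose_mul, conjTranspose_conjTranspose]
  re_inner_nonneg x := by
    have := (posSemidef_conjTranspose_mul_self x.1).trace_nonneg
    exact (Complex.nonneg_iff.1 this).1
  add_left x y z := by simp [add_mul]
  smul_left x y r := by simp
  definite x hx := Subtype.ext (trace_conjTranspose_mul_self_eq_zero_iff.1 hx)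

/-- A stabilising `g` is block diagonal, so `gᴴ` lies in the group. As `g` commutes with the adjoint
of the base matrix, `gᴴ` commutes with the base matrix and also stabilises the form. Moreover
`Ad(gᴴ)` is adjoint to `Ad(g)` for `tr(xᴴy)`. -/
theorem IsGradedParabolic.isOfReductiveType_baseForm (hq : IsGradedParabolic lev t q) :
    IsOfReductiveType q (baseForm lev t q) := by
  let _ : InnerProductSpace.Core ℂ q := traceCore q
  let _ : NormedAddCommGroup q := InnerProductSpace.Core.toNormedAddCommGroup (𝕜 := ℂ)
  let _ : InnerProductSpace ℂ q := InnerProductSpace.ofCore (traceCore q).toCore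
  refine isReductiveSubgroup_of_adjoint _ ?_
  rintro _ ⟨g, hg, rfl⟩
  obtain ⟨h1, h2, h3⟩ := hq.groupStabiliser_baseForm hg
  obtain ⟨g', hg'⟩ := hq.exists_gradedPart_conjTranspose g
  have hgr : gradedPart (grade lev t) (g.1 : Matrix (K ⊕ K) (K ⊕ K) ℂ) = g.1 := by
    ext i j
    simp only [gradedPart, of_apply]
    split_ifs with h
    · rfl
    · exact (h3 i j h).symm
  rw [hgr] at hg'
  have hginv : ((g'.1⁻¹ : GL (K ⊕ K) ℂ) : Matrix (K ⊕ K) (K ⊕ K) ℂ) =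
      ((g.1⁻¹ : GL (K ⊕ K) ℂ) : Matrix (K ⊕ K) (K ⊕ K) ℂ)ᴴ := by
    rw [Matrix.coe_units_inv, Matrix.coe_units_inv, hg', conjTranspose_nonsing_inv]
  refine ⟨_, ⟨g', ?_, rfl⟩, ?_⟩
  · change (Ad q).dual g' (baseForm lev t q) = _
    have hc : (g'.1 : Matrix (K ⊕ K) (K ⊕ K) ℂ) * baseMatrix lev t =
        baseMatrix lev t * (g'.1 : Matrix (K ⊕ K) (K ⊕ K) ℂ) := by
      have := congrArg conjTranspose h2
      rw [conjTranspose_mul, conjTranspose_mul, conjTranspose_conjTranspose] at this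
      rw [hg']
      exact this.symm
    rw [baseForm, dual_tracePairing, hc, mul_assoc, g'.1.mul_inv, mul_one]
  · intro x y
    change trace (x.1ᴴ * ((g.1 : Matrix (K ⊕ K) (K ⊕ K) ℂ) * y.1 *
        ((g.1⁻¹ : GL (K ⊕ K) ℂ) : Matrix (K ⊕ K) (K ⊕ K) ℂ))) =
      trace (((g'.1 : Matrix (K ⊕ K) (K ⊕ K) ℂ) * x.1 *
        ((g'.1⁻¹ : GL (K ⊕ K) ℂ) : Matrix (K ⊕ K) (K ⊕ K) ℂ))ᴴ * y.1)
    rw [hginv, hg', conjTranspose_mul, conjTranspose_mul, conjTranspose_conjTranspose,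
      conjTranspose_conjTranspose, ← mul_assoc, trace_mul_comm]
    simp only [mul_assoc]

end Graded

/-- The forms of reductive and nilpotent type make up the coadjoint orbit of the base form, and
stabilisers along an orbit are conjugate. The zero centre settles the semisimplicity condition. -/
theorem IsGradedParabolic.MStar_eq {K : Type*} [Fintype K] [DecidableEq K] {lev : K → ℕ} {t : ℕ}
    {q : LieSubalgebra ℂ (Matrix (K ⊕ K) (K ⊕ K) ℂ)} (hq : IsGradedParabolic lev t q) :
    MStar q = conjugacyClass q (lieStabiliser q (baseForm lev t q)) := by
  have hqr : IsStronglyQuasiReductive q := by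
    refine ⟨⟨_, hq.isOfReductiveType_baseForm⟩, fun z hz => ?_⟩
    have h0 : (z : Matrix (K ⊕ K) (K ⊕ K) ℂ) = 0 := by
      refine hq.eq_zero_of_commute z.2 fun y hy => ?_
      have h1 := (LieModule.mem_maxTrivSubmodule ℂ q q z).1 hz ⟨y, hy⟩
      exact (sub_eq_zero.1 (congrArg Subtype.val h1)).symm
    rw [h0, map_zero]
    exact Module.End.isSemisimple_zero
  ext m
  constructor
  · rintro ⟨-, γ, hr, hn, rfl⟩
    obtain ⟨g, hg⟩ := hq.exists_dual_eq_baseForm hr hn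
    refine ⟨g⁻¹, ?_⟩
    rw [← hg, ← lieStabiliser_dual, ← Module.End.mul_apply, ← map_mul, inv_mul_cancel, map_one,
      Module.End.one_apply]
  · rintro ⟨g, hg⟩
    refine ⟨hqr, (Ad q).dual g (baseForm lev t q), hq.isOfReductiveType_baseForm.dual g,
      hq.isOfNilpotentType_baseForm.dual g, ?_⟩
    rw [← LieSubalgebra.toSubmodule_inj, hg, lieStabiliser_dual]

/-! ### The standard parabolic subalgebras -/

section Standard

variable (ℓ : ℕ) {r : ℕ} (a : Composition r)

/-- The number of the block of an index; the last block has number `t`. -/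
def blockLevel : Idx ℓ a → ℕ := Sum.elim (fun s => s.1.val) fun _ => a.length

theorem blockLevel_le (k : Idx ℓ a) : blockLevel ℓ a k ≤ a.length := by
  rcases k with ⟨i, k⟩ | k
  · exact i.2.le
  · exact le_rfl

/-- Since `j ≤ t`, the last block and all `f_k`, of degree at least `t`, never contribute;
membership in the flag is a support condition on degrees below `j`. -/
theorem mem_flag_iff (j : Fin (a.length + 1)) (v : Idx ℓ a ⊕ Idx ℓ a → ℂ) :
    v ∈ flag ℓ a j ↔ ∀ s, j.val ≤ grade (blockLevel ℓ a) a.length s → v s = 0 := by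
  have hj := j.2
  constructor
  · intro hv s hs
    rw [flag] at hv
    induction hv using Submodule.span_induction with
    | zero => rfl
    | add v w _ _ hv hw => rw [Pi.add_apply, hv, hw, add_zero]
    | smul c v _ hv => rw [Pi.smul_apply, hv, smul_zero]
    | mem v hv =>
      obtain ⟨i, k, hij, rfl⟩ := hv
      refine Pi.single_eq_of_ne ?_ _
      rintro rfl
      simp only [grade, blockLevel, Sum.elim_inl] at hs
      omega
  · intro h
    rw [← Finset.univ_sum_single v]
    refine Submodule.sum_mem _ fun s _ => ?_
    have hsmul : (Pi.single s (v s) : Idx ℓ a ⊕ Idx ℓ a → ℂ) = v s • Pi.single s 1 := by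
      rw [← Pi.single_smul, smul_eq_mul, mul_one]
    rcases s with (⟨i, k⟩ | k) | k
    · by_cases hij : i.val < j.val
      · rw [hsmul]
        exact Submodule.smul_mem _ _ (Submodule.subset_span ⟨i, k, hij, rfl⟩)
      · rw [h _ (by simp only [grade, blockLevel, Sum.elim_inl]; omega), Pi.single_zero]
        exact zero_mem _
    · rw [h _ (by simp only [grade, blockLevel, Sum.elim_inl, Sum.elim_inr]; omega),
        Pi.single_zero]
      exact zero_mem _
    · have := blockLevel_le ℓ a k
      rw [h _ (by simp only [grade, Sum.elim_inr]; omega), Pi.single_zero]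
      exact zero_mem _

theorem isGradedParabolic_parabolic :
    IsGradedParabolic (blockLevel ℓ a) a.length (parabolic ℓ a) where
  le := blockLevel_le ℓ a
  mem_iff x := by
    have hle := blockLevel_le ℓ a
    change (x ∈ LieAlgebra.Symplectic.sp (Idx ℓ a) ℂ ∧
      ∀ j, ∀ v ∈ flag ℓ a j, x *ᵥ v ∈ flag ℓ a j) ↔ _
    refine and_congr_right fun hx => ⟨fun h => ?_, fun h j v hv => ?_⟩
    -- The flag constrains directly only the columns of the `e_l` below level `t`. The symplectic
    -- relations carry these constraints over to the remaining blocks.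
    · have hdir : ∀ (l : Idx ℓ a) (s : Idx ℓ a ⊕ Idx ℓ a), blockLevel ℓ a l < a.length →
          blockLevel ℓ a l < grade (blockLevel ℓ a) a.length s → x s (Sum.inl l) = 0 := by
        rintro (⟨i, k⟩ | k) s hl hs
        · have h1 := h i.succ (Pi.single (Sum.inl (Sum.inl ⟨i, k⟩)) 1)
            (Submodule.subset_span ⟨i, k, by simp, rfl⟩)
          rw [mem_flag_iff] at h1
          have h2 := h1 s (by rw [Fin.val_succ]; exact hs)
          rwa [Matrix.mulVec_single_one] at h2
        · exact absurd hl (lt_irrefl _)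
      obtain ⟨A, B, C, D, rfl⟩ : ∃ A B C D, x = fromBlocks A B C D :=
        ⟨_, _, _, _, (fromBlocks_toBlocks x).symm⟩
      obtain ⟨h1, h2, h3⟩ := mem_sp_iff.1 hx
      rintro (k | k) (l | l) hkl <;> simp only [grade, Sum.elim_inl, Sum.elim_inr] at hkl <;>
        have hk := hle k <;> have hl := hle l
      · exact hdir l (Sum.inl k) (by omega) hkl
      · omega
      · rcases lt_or_ge (blockLevel ℓ a l) a.length with hlt | hlt
        · exact hdir l (Sum.inr k) hlt hkl
        · simp only [fromBlocks_apply₂₁]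
          rw [← h3, transpose_apply]
          exact hdir k (Sum.inr l) (by omega) (by simp only [grade, Sum.elim_inr]; omega)
      · simp only [fromBlocks_apply₂₂]
        rw [h1, Matrix.neg_apply, transpose_apply, neg_eq_zero]
        exact hdir k (Sum.inl l) (by omega) (by simp only [grade, Sum.elim_inl]; omega)
    · rw [mem_flag_iff] at hv ⊢
      intro s hs
      rw [mulVec, dotProduct]
      refine Finset.sum_eq_zero fun u _ => ?_
      rcases lt_or_ge (grade (blockLevel ℓ a) a.length u) j.val with hu | hu
      · rw [h (lt_of_lt_of_le hu hs), zero_mul]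
      · rw [hv u hu, mul_zero]

variable {ℓ a}

theorem standardEmbedding_val (z : (⨁ i : Fin a.length,
      LieAlgebra.Orthogonal.so (Fin (a.blocksFun i)) ℂ) ×
      LieAlgebra.Symplectic.sp (Fin (ℓ - r)) ℂ) :
    (standardEmbedding ℓ a z : Matrix (Idx ℓ a ⊕ Idx ℓ a) (Idx ℓ a ⊕ Idx ℓ a) ℂ) =
      leviMatrix ℓ a (fun i => (z.1 i).1) z.2.1 := rfl

theorem leviMatrix_eq (x : ∀ i : Fin a.length, Matrix (Fin (a.blocksFun i)) (Fin (a.blocksFun i)) ℂ)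
    (A B C : Matrix (Fin (ℓ - r)) (Fin (ℓ - r)) ℂ) :
    leviMatrix ℓ a x (fromBlocks A B C (-Aᵀ)) =
      fromBlocks (fromBlocks (blockDiagonal' x) 0 0 A) (fromBlocks 0 0 0 B)
        (fromBlocks 0 0 0 C) (-(fromBlocks (blockDiagonal' x) 0 0 A)ᵀ) := by
  simp [leviMatrix, fromBlocks_transpose, fromBlocks_neg]

variable (ℓ a)

theorem standardEmbedding_injective : Function.Injective (standardEmbedding ℓ a) := by
  intro z w h
  have h1 := congrArg Subtype.val h
  rw [standardEmbedding_val, standardEmbedding_val] at h1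
  simp only [leviMatrix, fromBlocks_inj] at h1
  obtain ⟨⟨hx, -, -, h11⟩, ⟨-, -, -, h12⟩, ⟨-, -, -, h21⟩, ⟨-, -, -, h22⟩⟩ := h1
  refine Prod.ext (DFinsupp.ext fun i => Subtype.ext ?_) (Subtype.ext ?_)
  · exact congrFun (blockDiagonal'_injective hx) i
  · rw [← fromBlocks_toBlocks z.2.1, h11, h12, h21, h22, fromBlocks_toBlocks]

theorem range_standardEmbedding :
    (standardEmbedding ℓ a).range =
      lieStabiliser (parabolic ℓ a) (baseForm (blockLevel ℓ a) a.length (parabolic ℓ a)) := by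
  have hq := isGradedParabolic_parabolic ℓ a
  ext x
  rw [LieHom.mem_range]
  constructor
  · rintro ⟨z, rfl⟩
    obtain ⟨A, B, C, D, hABCD⟩ : ∃ A B C D, z.2.1 = fromBlocks A B C D :=
      ⟨_, _, _, _, (fromBlocks_toBlocks _).symm⟩
    have hsp := z.2.2
    rw [hABCD, mem_sp_iff] at hsp
    obtain ⟨rfl, hB, hC⟩ := hsp
    have hval := standardEmbedding_val z
    rw [hABCD, leviMatrix_eq] at hval
    have hmem := (standardEmbedding ℓ a z).2
    rw [hval] at hmem
    have heq : standardEmbedding ℓ a z = ⟨_, hmem⟩ := Subtype.ext hval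
    rw [heq, hq.mem_lieStabiliser_baseForm]
    refine ⟨?_, ?_, ?_, ?_, ?_, ?_⟩
    · rintro (⟨i, k⟩ | k) (⟨j, l⟩ | l) hkl
      · rw [fromBlocks_apply₁₁, blockDiagonal'_apply_ne]
        rintro rfl
        exact hkl rfl
      · rfl
      · rfl
      · exact absurd rfl hkl
    · rintro (⟨i, k⟩ | k) (⟨j, l⟩ | l) hk
      · rw [fromBlocks_apply₁₁, fromBlocks_apply₁₁]
        rcases eq_or_ne i j with rfl | hij
        · rw [blockDiagonal'_apply_eq, blockDiagonal'_apply_eq]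
          have := (LieAlgebra.Orthogonal.mem_so _ _ _).1 (z.1 i).2
          exact congrFun (congrFun this k) l
        · rw [blockDiagonal'_apply_ne _ _ _ hij, blockDiagonal'_apply_ne _ _ _ hij.symm, neg_zero]
      · simp
      · exact absurd hk (lt_irrefl _)
      · exact absurd hk (lt_irrefl _)
    · simp [fromBlocks_transpose, hB]
    · simp [fromBlocks_transpose, hC]
    · rintro (⟨i, k⟩ | k) (⟨j, l⟩ | l) hk
      · rfl
      · rfl
      · rfl
      · exact absurd hk (lt_irrefl _)
    · rintro (⟨i, k⟩ | k) (⟨j, l⟩ | l) hk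
      · rfl
      · rfl
      · rfl
      · exact absurd hk (lt_irrefl _)
  · intro hx
    obtain ⟨A, B, C, h, hval⟩ := hq.exists_levelSkew hx
    have hlt : ∀ s, blockLevel ℓ a (Sum.inl s) < a.length := fun s => s.1.2
    have hBs : ∀ k l, B k l = B l k := fun k l => by conv_lhs => rw [← h.symmB, transpose_apply]
    have hCs : ∀ k l, C k l = C l k := fun k l => by conv_lhs => rw [← h.symmC, transpose_apply]
    let u : Π₀ i : Fin a.length, LieAlgebra.Orthogonal.so (Fin (a.blocksFun i)) ℂ :=
      DFinsupp.equivFunOnFintype.symm fun i =>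
        ⟨Matrix.of fun k l => A (Sum.inl ⟨i, k⟩) (Sum.inl ⟨i, l⟩), by
          rw [LieAlgebra.Orthogonal.mem_so]
          ext k l
          exact h.skew _ _ (hlt _)⟩
    let y : LieAlgebra.Symplectic.sp (Fin (ℓ - r)) ℂ :=
      ⟨fromBlocks A.toBlocks₂₂ B.toBlocks₂₂ C.toBlocks₂₂ (-A.toBlocks₂₂ᵀ), by
        rw [mem_sp_iff]
        refine ⟨rfl, ?_, ?_⟩
        · ext k l; exact hBs _ _
        · ext k l; exact hCs _ _⟩
    refine ⟨(u, y), Subtype.ext ?_⟩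
    rw [standardEmbedding_val, leviMatrix_eq, hval]
    have eA : fromBlocks (blockDiagonal' fun i => (u i).1) 0 0 A.toBlocks₂₂ = A := by
      ext (⟨i, k⟩ | k) (⟨j, l⟩ | l)
      · rw [fromBlocks_apply₁₁]
        rcases eq_or_ne i j with rfl | hij
        · rw [blockDiagonal'_apply_eq]
          rfl
        · rw [blockDiagonal'_apply_ne _ _ _ hij, h.diag]
          exact fun e => hij (Fin.ext e)
      · exact (h.diag _ _ (hlt _).ne).symm
      · exact (h.diag (Sum.inr k) (Sum.inl ⟨j, l⟩) (hlt ⟨j, l⟩).ne').symm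
      · rfl
    have eB : fromBlocks 0 0 0 B.toBlocks₂₂ = B := by
      ext (k | k) (l | l)
      · exact (h.zeroB _ _ (hlt _)).symm
      · exact (h.zeroB _ _ (hlt _)).symm
      · exact ((hBs _ _).trans (h.zeroB _ _ (hlt _))).symm
      · rfl
    have eC : fromBlocks 0 0 0 C.toBlocks₂₂ = C := by
      ext (k | k) (l | l)
      · exact (h.zeroC _ _ (hlt _)).symm
      · exact (h.zeroC _ _ (hlt _)).symm
      · exact ((hCs _ _).trans (h.zeroC _ _ (hlt _))).symm
      · rfl
    rw [eA, eB, eC]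

end Standard

end MaxRed

/-- Strong quasi-reductivity is contained in the equality: the conjugacy class contains the range
itself, whereas `MStar` would otherwise be empty. -/
theorem theorem5p5 (ℓ r : ℕ) (hr : 1 ≤ r) (hrl : r ≤ ℓ) (a : Composition r) :
    Function.Injective (MaxRed.standardEmbedding ℓ a) ∧
      MaxRed.MStar (MaxRed.parabolic ℓ a) =
        MaxRed.conjugacyClass (MaxRed.parabolic ℓ a) (MaxRed.standardEmbedding ℓ a).range :=
  ⟨MaxRed.standardEmbedding_injective ℓ a, by
    rw [MaxRed.range_standardEmbedding, (MaxRed.isGradedParabolic_parabolic ℓ a).MStar_eq]⟩
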